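/- Let $\lambda>\lambda_0:=3/2^{2/3}$ be fixed. For $t\in\mathbb R$ let $\underline U(t)$ and $\bar U(t)$ denote the smallest and the largest real root of $u^3-\lambda u+\cos t=0$. Consider the forced Duffing equation $$\varepsilon^2u''=u^3-\lambda u+\cos t,\qquad t\in\mathbb R.\tag{1}$$ For every integer $m\ge 1$ there is an $\varepsilon_m>0$ (depending on $\lambda$ and $m$) such that for each $\varepsilon\in(0,\varepsilon_m)$ equation (1) has a solution $u=u_\varepsilon$ on $\mathbb R$ with $u'(0)=u'(\pi)=0$, $u(\pi/2)=0$, $u'(\pi/2)<0$, and with exactly $m$ local minima $s_1,\dots,s_m$ and exactly $m$ local maxima $t_1,\dots,t_m$ in $[\pi/2,\pi]$ (an "up-wind" internal-layer solution). They satisfy $$\frac{\pi}{2}<s_1<t_1<s_2<t_2<\cdots<s_m<t_m=\pi,$$ and $$u'(t)>0,\qquad \underline U(\pi/2)<u(t)<\underline U(\pi)\qquad\text{for } s_m<t<\pi.$$ Moreover, for this family of solutions, as $\varepsilon\to0^+$, $$s_j\to\frac{\pi}{2},\quad u(s_j)\to\underline U(\pi/2)\quad(1\le j\le m),\qquad t_j\to\frac{\pi}{2},\quad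 u(t_j)\to\bar U(\pi/2)\quad(1\le j\le m-1).$$ -/

import Mathlib

open Filter Topology Set

noncomputable section

namespace ForcedDuffing

/-- The critical parameter `λ₀ = 3 / 2^(2/3)`. -/
def lambda0 : ℝ := 3 / (2 : ℝ) ^ ((2 : ℝ) / 3)

/-- `u` is a (classical, twice continuously differentiable) solution on the whole real line of
`ε² u'' = u³ - λ u + cos t`. -/
def IsSolution (lam ε : ℝ) (u : ℝ → ℝ) : Prop :=
  ContDiff ℝ 2 u ∧
    ∀ t : ℝ, ε ^ 2 * deriv (deriv u) t = u t ^ 3 - lam * u t + Real.cos t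

/-- The set of real roots of `u³ - λ u + cos t = 0` at time `t`. -/
def rootSet (lam t : ℝ) : Set ℝ := {u : ℝ | u ^ 3 - lam * u + Real.cos t = 0}

/-- The lower branch: the smallest root of `u³ - λ u + cos t = 0`. -/
def Ulow (lam t : ℝ) : ℝ := sInf (rootSet lam t)

/-- The upper branch: the largest root of `u³ - λ u + cos t = 0`. -/
def Ubar (lam t : ℝ) : ℝ := sSup (rootSet lam t)

theorem rootSet_subset (lam t : ℝ) :
    rootSet lam t ⊆ Icc (-(|lam| + 2)) (|lam| + 2) := by
  intro u hu
  have h : u ^ 3 - lam * u + Real.cos t = 0 := hu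
  have h1 := Real.neg_one_le_cos t
  have h2 := Real.cos_le_one t
  have ha := abs_nonneg lam
  have hb := le_abs_self lam
  by_contra hc
  rw [mem_Icc, not_and_or, not_le, not_le] at hc
  rcases hc with hc | hc
  · nlinarith [mul_pos (show (0 : ℝ) < -u - 1 by linarith) (show (0 : ℝ) < -u by linarith),
      mul_nonneg (show (0 : ℝ) ≤ -u by linarith) (show (0 : ℝ) ≤ u ^ 2 - lam - 2 by nlinarith)]
  · nlinarith [mul_pos (show (0 : ℝ) < u - 1 by linarith) (show (0 : ℝ) < u by linarith),
      mul_nonneg (show (0 : ℝ) ≤ u by linarith) (show (0 : ℝ) ≤ u ^ 2 - lam - 2 by nlinarith)]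

theorem rootSet_nonempty (lam t : ℝ) : (rootSet lam t).Nonempty := by
  have h1 := Real.neg_one_le_cos t
  have h2 := Real.cos_le_one t
  have ha := abs_nonneg lam
  have hb := le_abs_self lam
  have hab : -(|lam| + 2) ≤ |lam| + 2 := by linarith
  have hf : ContinuousOn (fun u : ℝ => u ^ 3 - lam * u + Real.cos t)
      (Icc (-(|lam| + 2)) (|lam| + 2)) := by fun_prop
  have key : 1 ≤ (|lam| + 2) ^ 3 - lam * (|lam| + 2) := by
    nlinarith [mul_nonneg ha ha, mul_nonneg (mul_nonneg ha ha) ha]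
  obtain ⟨u, -, hu⟩ := intermediate_value_Icc hab hf
    (show (0 : ℝ) ∈ Icc _ _ from ⟨by nlinarith, by nlinarith⟩)
  exact ⟨u, hu⟩

theorem rootSet_isCompact (lam t : ℝ) : IsCompact (rootSet lam t) :=
  isCompact_Icc.of_isClosed_subset
    (isClosed_eq (by fun_prop) continuous_const) (rootSet_subset lam t)

theorem Ulow_isLeast (lam t : ℝ) : IsLeast (rootSet lam t) (Ulow lam t) :=
  (rootSet_isCompact lam t).isLeast_sInf (rootSet_nonempty lam t)

theorem Ubar_isGreatest (lam t : ℝ) : IsGreatest (rootSet lam t) (Ubar lam t) :=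
  (rootSet_isCompact lam t).isGreatest_sSup (rootSet_nonempty lam t)

end ForcedDuffing

end

namespace ForcedDuffing

/-! ### Global solutions of bounded Lipschitz fields and continuous dependence -/

section Flow

variable {E : Type*} [NormedAddCommGroup E] [NormedSpace ℝ E]

/-! In the reversed time r = π − t the equation reads ε²R'' = R³ − λR − cos r, and one shoots from
R(0) = α, R'(0) = 0. Reflection about r = 0, and reflection about r = π/2 combined with R ↦ −R,
preserve the equation. Hence a shot with R(π/2) = 0 gives a global solution with R'(π) = 0
(`exists_shots`), and it remains to find a shot with exactly 2m − 1 zeros in [0, π/2], the last one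
at π/2.

Because λ > λ₀, the lower branch L is smooth, stays left of the turning point of the cubic, and
decreases on [0, π/2]. A shot from α < L(0) first falls; its first critical point σ, if there is
one, lies strictly above L. From then on the energy relative to L is negative and nonincreasing, so
the shot can reach neither L nor √λ (`IsShot.trapped`). If σ is within δ of π/2, then R(σ) is close
to −√λ and the autonomous energy stays close to the heteroclinic level (`IsShot.isTrapped`). Hence
zeros are simple and crossed at speed at least λ/(4ε), and critical points have values near ±√λ.

A trapped shot cannot keep one sign for long. While positive it is bent down by cos r. While
negative it comes near L, but the drift of L keeps it at a height of order ε above L, so that its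
acceleration is at least of order 1/ε. So every window of fixed length contains a zero once ε is
small (`IsTrapped.exists_zero`).

The shot is then selected by two minimisations over α. The first (`exists_shot_first_critical_eq`)
gives a shot with σ = π/2 − δ, which has at least 2m − 1 zeros. The second
(`exists_shot_with_zeros`) takes the smallest α with 2m − 1 zeros: if these were all before π/2 they
would persist for smaller α, so the last one sits at π/2 and no others exist. Between consecutive
zeros the acceleration has a definite sign at critical points, so there is exactly one critical
point, and minima and maxima alternate. The limits follow from the energy bound with δ → 0, made
uniform over one family by a diagonal choice. -/

theorem exists_global_solution [CompleteSpace E] {f : ℝ → E → E} {K L : NNReal}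
    (hK : ∀ t, LipschitzWith K (f t)) (hc : ∀ x, Continuous fun t => f t x)
    (hL : ∀ t x, ‖f t x‖ ≤ L) (x₀ : E) :
    ∃ y : ℝ → E, y 0 = x₀ ∧ ∀ t, HasDerivAt y (f t (y t)) t := by
  have hloc : ∀ n : ℕ, ∃ y : ℝ → E, y 0 = x₀ ∧
      ∀ t ∈ Ioo (-((n : ℝ) + 1)) ((n : ℝ) + 1), HasDerivAt y (f t (y t)) t := by
    intro n
    have hn : (0 : ℝ) ≤ (n : ℝ) + 1 := by positivity
    -- The field is bounded by `L`, so a ball of radius `L * (n + 1)` cannot be left and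
    -- Picard–Lindelöf covers the whole interval.
    have hpl : IsPicardLindelof f
        (⟨0, by constructor <;> linarith⟩ : Icc (-((n : ℝ) + 1)) ((n : ℝ) + 1)) x₀
        (L * ⟨(n : ℝ) + 1, hn⟩) 0 L K :=
      { lipschitzOnWith := fun t _ => (hK t).lipschitzOnWith
        continuousOn := fun x _ => (hc x).continuousOn
        norm_le := fun t _ x _ => hL t x
        mul_max_le := by simp only [sub_zero, zero_sub, neg_neg, max_self, NNReal.coe_zero]; exact le_rfl }
    obtain ⟨y, hy0, hy⟩ := hpl.exists_eq_forall_mem_Icc_hasDerivWithinAt₀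
    exact ⟨y, hy0, fun t ht => (hy t (Ioo_subset_Icc_self ht)).hasDerivAt (Icc_mem_nhds ht.1 ht.2)⟩
  choose y hy0 hy using hloc
  have hagree : ∀ n k : ℕ, n ≤ k → ∀ t ∈ Ioo (-((n : ℝ) + 1)) ((n : ℝ) + 1), y n t = y k t := by
    intro n k hnk
    have hnk' : (n : ℝ) ≤ k := by exact_mod_cast hnk
    have hn : (0 : ℝ) < (n : ℝ) + 1 := by positivity
    exact ODE_solution_unique_of_mem_Ioo (t₀ := 0) (s := fun _ => univ) (v := f) (K := K)
      (fun t _ => (hK t).lipschitzOnWith) ⟨by linarith, hn⟩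
      (fun t ht => ⟨hy n t ht, trivial⟩)
      (fun t ht => ⟨hy k t ⟨by linarith [ht.1], by linarith [ht.2]⟩, trivial⟩)
      (by rw [hy0, hy0])
  -- Uniqueness glues the local solutions; the half-length `n + 1` keeps `t` interior when `n =
  -- ⌈|t|⌉₊`.
  refine ⟨fun t => y ⌈|t|⌉₊ t, by simp [hy0], fun t => ?_⟩
  obtain ⟨N, hN⟩ := exists_nat_gt |t|
  have hev : ∀ᶠ s : ℝ in 𝓝 t, |s| < N := (continuous_abs.tendsto t).eventually (gt_mem_nhds hN)
  have heq : ∀ s : ℝ, |s| < N → y ⌈|s|⌉₊ s = y N s := by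
    intro s hs
    apply hagree _ _ (Nat.ceil_le.2 hs.le)
    have := Nat.le_ceil |s|
    exact ⟨by linarith [neg_abs_le s], by linarith [le_abs_self s]⟩
  have hd : HasDerivAt (y N) (f t (y N t)) t :=
    hy N t ⟨by linarith [neg_abs_le t], by linarith [le_abs_self t]⟩
  simp only [heq t hN]
  exact hd.congr_of_eventuallyEq (hev.mono heq)

theorem dist_solution_le {f : ℝ → E → E} {K : NNReal} (hK : ∀ t, LipschitzWith K (f t))
    {y z : ℝ → E} (hy : ∀ t, HasDerivAt y (f t (y t)) t) (hz : ∀ t, HasDerivAt z (f t (z t)) t)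
    (t : ℝ) : dist (y t) (z t) ≤ dist (y 0) (z 0) * Real.exp (K * |t|) := by
  have key : ∀ {g : ℝ → E → E} (_ : ∀ t, LipschitzWith K (g t)) {y z : ℝ → E}
      (_ : ∀ t, HasDerivAt y (g t (y t)) t) (_ : ∀ t, HasDerivAt z (g t (z t)) t) (t : ℝ), 0 ≤ t →
      dist (y t) (z t) ≤ dist (y 0) (z 0) * Real.exp (K * t) := by
    intro g hg y z hy hz t ht
    have := dist_le_of_trajectories_ODE (v := g) (K := K) (f := y) (g := z) (a := 0) (b := t)
      (δ := dist (y 0) (z 0)) hg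
      (fun s _ => (hy s).continuousAt.continuousWithinAt)
      (fun s _ => (hy s).hasDerivWithinAt)
      (fun s _ => (hz s).continuousAt.continuousWithinAt)
      (fun s _ => (hz s).hasDerivWithinAt) le_rfl t ⟨ht, le_rfl⟩
    simpa using this
  rcases le_total 0 t with ht | ht
  · rw [abs_of_nonneg ht]; exact key hK hy hz t ht
  · rw [abs_of_nonpos ht]
    have hrev : ∀ {y : ℝ → E}, (∀ t, HasDerivAt y (f t (y t)) t) →
        ∀ t, HasDerivAt (fun s => y (-s)) (-f (-t) (y (-t))) t := by
      intro y hy t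
      simpa [Function.comp_def] using (hy (-t)).scomp t (hasDerivAt_neg t)
    have := key (g := fun t x => -f (-t) x) (fun t => (hK (-t)).neg) (hrev hy) (hrev hz) (-t)
      (by linarith)
    simpa using this

theorem continuous_flow {f : ℝ → E → E} {K : NNReal} (hK : ∀ t, LipschitzWith K (f t))
    {ι : Type*} [TopologicalSpace ι] {Y : ι → ℝ → E} (h0 : Continuous fun i => Y i 0)
    (hY : ∀ i t, HasDerivAt (Y i) (f t (Y i t)) t) : Continuous fun p : ι × ℝ => Y p.1 p.2 := by
  rw [continuous_iff_continuousAt]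
  rintro ⟨i, t⟩
  rw [ContinuousAt, tendsto_iff_dist_tendsto_zero]
  have hb : ∀ p : ι × ℝ, dist (Y p.1 p.2) (Y i t) ≤
      dist (Y p.1 0) (Y i 0) * Real.exp (K * |p.2|) + dist (Y i p.2) (Y i t) := fun p =>
    (dist_triangle _ (Y i p.2) _).trans
      (add_le_add_left (dist_solution_le hK (hY p.1) (hY i) p.2) _)
  have hcont : Continuous (Y i) :=
    continuous_iff_continuousAt.2 fun s => (hY i s).continuousAt
  have hlim : Tendsto (fun p : ι × ℝ => dist (Y p.1 0) (Y i 0) * Real.exp (K * |p.2|) +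
      dist (Y i p.2) (Y i t)) (𝓝 (i, t)) (𝓝 0) := by
    have hc : Continuous (fun p : ι × ℝ => dist (Y p.1 0) (Y i 0) * Real.exp (K * |p.2|) +
      dist (Y i p.2) (Y i t)) := by
      have := h0.comp (continuous_fst (X := ι) (Y := ℝ))
      have h2 := hcont.comp (continuous_snd (X := ι) (Y := ℝ))
      exact ((this.dist continuous_const).mul (by fun_prop)).add (h2.dist continuous_const)
    simpa using hc.tendsto (i, t)
  exact squeeze_zero (fun _ => dist_nonneg) hb hlim

end Flow

/-! ### The clamped shooting problem and its symmetries -/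

/-- The cubic `v³ - λ v`. -/
def cubic (lam v : ℝ) : ℝ := v ^ 3 - lam * v

/-- The projection of the real line onto `[-k, k]`. -/
def clamp (k v : ℝ) : ℝ := max (-k) (min k v)

theorem clamp_of_abs_le {k v : ℝ} (h : |v| ≤ k) : clamp k v = v := by
  rw [abs_le] at h
  simp [clamp, h.1, h.2]

theorem abs_clamp_le {k : ℝ} (hk : 0 ≤ k) (v : ℝ) : |clamp k v| ≤ k :=
  abs_le.2 ⟨le_max_left _ _, max_le (by linarith) (min_le_left _ _)⟩

theorem clamp_neg {k : ℝ} (hk : 0 ≤ k) (v : ℝ) : clamp k (-v) = -clamp k v := by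
  unfold clamp
  grind

theorem abs_clamp_sub_le (k v w : ℝ) : |clamp k v - clamp k w| ≤ |v - w| := by
  unfold clamp
  grind

theorem abs_cubic_le {lam v : ℝ} (hlam : 0 ≤ lam) (hv : |v| ≤ √lam) :
    |cubic lam v| ≤ √lam * lam := by
  have h2 : v ^ 2 ≤ lam := by
    rw [← sq_abs, ← Real.sq_sqrt hlam]; exact pow_le_pow_left₀ (abs_nonneg v) hv 2
  have : cubic lam v = v * (v ^ 2 - lam) := by unfold cubic; ring
  rw [this, abs_mul]
  have h3 : |v ^ 2 - lam| ≤ lam := abs_le.2 ⟨by nlinarith, by linarith⟩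
  exact mul_le_mul hv h3 (abs_nonneg _) (Real.sqrt_nonneg _)

theorem abs_cubic_sub_le {lam v w : ℝ} (hlam : 0 ≤ lam) (hv : |v| ≤ √lam) (hw : |w| ≤ √lam) :
    |cubic lam v - cubic lam w| ≤ 4 * lam * |v - w| := by
  have hv2 : v ^ 2 ≤ lam := by
    rw [← sq_abs, ← Real.sq_sqrt hlam]; exact pow_le_pow_left₀ (abs_nonneg v) hv 2
  have hw2 : w ^ 2 ≤ lam := by
    rw [← sq_abs, ← Real.sq_sqrt hlam]; exact pow_le_pow_left₀ (abs_nonneg w) hw 2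
  have : cubic lam v - cubic lam w = (v ^ 2 + v * w + w ^ 2 - lam) * (v - w) := by
    unfold cubic; ring
  rw [this, abs_mul]
  apply mul_le_mul_of_nonneg_right _ (abs_nonneg _)
  rw [abs_le]
  constructor <;> nlinarith [sq_nonneg (v - w), sq_nonneg (v + w)]

/-- `R` and `S = R'` solve the equation `ε² R'' = R³ - λ R - cos r`, in which the values of `R`
are clamped to `[-√λ, √λ]`, with `R 0 = α` and `R' 0 = 0`. -/
structure IsShot (lam ε α : ℝ) (R S : ℝ → ℝ) : Prop where
  R_zero : R 0 = α
  S_zero : S 0 = 0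
  continuous_R : Continuous R
  hasDerivAt_R : ∀ r ∈ Icc 0 (Real.pi / 2), HasDerivAt R (S r) r
  hasDerivAt_S : ∀ r, HasDerivAt S ((cubic lam (clamp (√lam) (R r)) - Real.cos r) / ε ^ 2) r

theorem IsShot.continuous_S {lam ε α : ℝ} {R S : ℝ → ℝ} (h : IsShot lam ε α R S) :
    Continuous S :=
  continuous_iff_continuousAt.2 fun r => (h.hasDerivAt_S r).continuousAt

/-- The clamped first order system; the momentum is clamped to `[-M, M]` as well. -/
noncomputable def clampedField (lam ε M : ℝ) (r : ℝ) (p : ℝ × ℝ) : ℝ × ℝ :=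
  (clamp M p.2, (cubic lam (clamp (√lam) p.1) - Real.cos r) / ε ^ 2)

theorem abs_clamped_acceleration_le {lam ε : ℝ} (hlam : 0 ≤ lam) (v r : ℝ) :
    |(cubic lam (clamp (√lam) v) - Real.cos r) / ε ^ 2| ≤ (√lam * lam + 1) / ε ^ 2 := by
  rw [abs_div, abs_of_nonneg (sq_nonneg ε)]
  apply div_le_div_of_nonneg_right _ (sq_nonneg ε)
  exact (abs_sub _ _).trans (add_le_add
    (abs_cubic_le hlam (abs_clamp_le (Real.sqrt_nonneg _) _)) (Real.abs_cos_le_one r))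

theorem clampedField_lipschitz {lam : ℝ} (hlam : 0 ≤ lam) (ε M : ℝ) (r : ℝ) :
    LipschitzWith (max 1 (Real.toNNReal (4 * lam / ε ^ 2))) (clampedField lam ε M r) := by
  have h1 : LipschitzWith 1 fun p : ℝ × ℝ => clamp M p.2 := by
    refine LipschitzWith.of_dist_le_mul fun p q => ?_
    rw [NNReal.coe_one, one_mul, Real.dist_eq]
    exact (abs_clamp_sub_le _ _ _).trans ((Real.dist_eq _ _).symm.le.trans (le_max_right _ _))
  have h2 : LipschitzWith (Real.toNNReal (4 * lam / ε ^ 2))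
      fun p : ℝ × ℝ => (cubic lam (clamp (√lam) p.1) - Real.cos r) / ε ^ 2 := by
    refine LipschitzWith.of_dist_le_mul fun p q => ?_
    rw [Real.coe_toNNReal _ (by positivity), Real.dist_eq, ← sub_div, sub_sub_sub_cancel_right,
      abs_div, abs_of_nonneg (sq_nonneg ε), div_mul_eq_mul_div]
    apply div_le_div_of_nonneg_right _ (sq_nonneg ε)
    have hk := Real.sqrt_nonneg lam
    refine (abs_cubic_sub_le hlam (abs_clamp_le hk _) (abs_clamp_le hk _)).trans ?_
    apply mul_le_mul_of_nonneg_left _ (by positivity)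
    exact (abs_clamp_sub_le _ _ _).trans ((Real.dist_eq _ _).symm.le.trans (le_max_left _ _))
  exact h1.prodMk h2

/-- Clamping makes the field bounded and Lipschitz, hence gives a global flow continuous in α. For a
shot that stays in [−√λ, √λ] up to π/2 and vanishes there, the two reflections carry the bounds from
[0, π/2] to the whole line, so both clamps are inactive. -/
theorem exists_shots {lam ε : ℝ} (hlam : 0 < lam) (hε : 0 < ε) :
    ∃ R S : ℝ → ℝ → ℝ, (∀ α, IsShot lam ε α (R α) (S α)) ∧
      Continuous (fun p : ℝ × ℝ => R p.1 p.2) ∧ Continuous (fun p : ℝ × ℝ => S p.1 p.2) ∧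
      ∀ α, (∀ r ∈ Icc 0 (Real.pi / 2), |R α r| ≤ √lam) → R α (Real.pi / 2) = 0 →
        (∀ r, HasDerivAt (R α) (S α r) r) ∧
        (∀ r, HasDerivAt (S α) ((cubic lam (R α r) - Real.cos r) / ε ^ 2) r) ∧
        S α Real.pi = 0 := by
  set B : ℝ := √lam * lam + 1 with hB
  have hk := Real.sqrt_nonneg lam
  have hBpos : 0 < B := by positivity
  -- The acceleration is at most B/ε² and π/2 < 2, so the momentum, starting at 0, does not exceed
  -- `M` on [0, π/2].
  set M : ℝ := 2 * B / ε ^ 2 with hM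
  have hMpos : 0 < M := by positivity
  set F := clampedField lam ε M with hF
  have hLip := clampedField_lipschitz hlam.le ε M
  have hcont : ∀ x, Continuous fun t => F t x := by
    intro x; simp only [hF, clampedField]; fun_prop
  have hbound : ∀ t x, ‖F t x‖ ≤ (⟨M, hMpos.le⟩ : NNReal) := by
    intro t x
    refine max_le ?_ ?_
    · exact abs_clamp_le hMpos.le _
    · refine (abs_clamped_acceleration_le hlam.le _ _).trans ?_
      change B / ε ^ 2 ≤ M
      rw [hM]; gcongr; linarith
  choose Y hY0 hY using fun α : ℝ => exists_global_solution hLip hcont hbound (α, (0 : ℝ))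
  have hYc : Continuous fun p : ℝ × ℝ => Y p.1 p.2 :=
    continuous_flow hLip (by simp only [hY0]; fun_prop) hY
  have hd1 : ∀ α r, HasDerivAt (fun r => (Y α r).1) (clamp M (Y α r).2) r := fun α r =>
    (hasFDerivAt_fst (𝕜 := ℝ) (p := Y α r)).comp_hasDerivAt r (hY α r)
  have hd2 : ∀ α r, HasDerivAt (fun r => (Y α r).2)
      ((cubic lam (clamp (√lam) (Y α r).1) - Real.cos r) / ε ^ 2) r := fun α r =>
    (hasFDerivAt_snd (𝕜 := ℝ) (p := Y α r)).comp_hasDerivAt r (hY α r)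
  have hSb : ∀ α, ∀ r ∈ Icc 0 (Real.pi / 2), |(Y α r).2| ≤ M := by
    intro α r hr
    have := (convex_univ (𝕜 := ℝ) (E := ℝ)).norm_image_sub_le_of_norm_hasDerivWithin_le (x := 0)
      (y := r) (fun x _ => (hd2 α x).hasDerivWithinAt)
      (fun x _ => abs_clamped_acceleration_le hlam.le _ _) trivial trivial
    simp only [hY0, sub_zero, Real.norm_eq_abs, abs_of_nonneg hr.1] at this
    refine this.trans ?_
    rw [hM, ← hB, mul_comm, mul_div_assoc]
    have := Real.pi_lt_four
    exact mul_le_mul_of_nonneg_right (by linarith [hr.2]) (by positivity)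
  have hshot : ∀ α, IsShot lam ε α (fun r => (Y α r).1) (fun r => (Y α r).2) := fun α =>
    { R_zero := by simp [hY0]
      S_zero := by simp [hY0]
      continuous_R := continuous_iff_continuousAt.2 fun r => (hd1 α r).continuousAt
      hasDerivAt_R := fun r hr => by
        have := hd1 α r
        rwa [clamp_of_abs_le (hSb α r hr)] at this
      hasDerivAt_S := hd2 α }
  refine ⟨fun α r => (Y α r).1, fun α r => (Y α r).2, hshot, hYc.fst, hYc.snd,
    fun α hR hmid => ?_⟩
  have huniq : ∀ (Z : ℝ → ℝ × ℝ) (t₀ : ℝ), (∀ t, HasDerivAt Z (F t (Z t)) t) → Z t₀ = Y α t₀ →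
      ∀ t, Z t = Y α t := fun Z t₀ hZ h => congrFun (ODE_solution_unique_univ (v := F)
        (s := fun _ => univ) (t₀ := t₀) (fun t => (hLip t).lipschitzOnWith)
        (fun t => ⟨hZ t, trivial⟩) (fun t => ⟨hY α t, trivial⟩) h)
  have heven : ∀ r, ((Y α (-r)).1, -(Y α (-r)).2) = Y α r := by
    refine huniq (fun r => ((Y α (-r)).1, -(Y α (-r)).2)) 0 (fun r => ?_) (by simp [hY0])
    have e1 : HasDerivAt (fun r => (Y α (-r)).1) (-clamp M (Y α (-r)).2) r := by
      simpa [Function.comp_def] using (hd1 α (-r)).scomp r (hasDerivAt_neg r)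
    have e2 : HasDerivAt (fun r => (Y α (-r)).2)
        (-((cubic lam (clamp (√lam) (Y α (-r)).1) - Real.cos r) / ε ^ 2)) r := by
      simpa [Function.comp_def] using (hd2 α (-r)).scomp r (hasDerivAt_neg r)
    have := e1.prodMk e2.neg
    simpa [hF, clampedField, clamp_neg hMpos.le] using this
  -- The reflected trajectory agrees with the original at π/2 precisely because R(π/2) = 0.
  have hodd : ∀ r, (-(Y α (Real.pi - r)).1, (Y α (Real.pi - r)).2) = Y α r := by
    refine huniq (fun r => (-(Y α (Real.pi - r)).1, (Y α (Real.pi - r)).2)) (Real.pi / 2)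
      (fun r => ?_) ?_
    · have e0 : HasDerivAt (fun r => Real.pi - r) (-1) r := by
        simpa using (hasDerivAt_id r).const_sub Real.pi
      have e1 : HasDerivAt (fun r => (Y α (Real.pi - r)).1) (-clamp M (Y α (Real.pi - r)).2) r := by
        simpa [Function.comp_def] using (hd1 α (Real.pi - r)).scomp r e0
      have e2 : HasDerivAt (fun r => (Y α (Real.pi - r)).2)
          (-((cubic lam (clamp (√lam) (Y α (Real.pi - r)).1) + Real.cos r) / ε ^ 2)) r := by
        simpa [Function.comp_def] using (hd2 α (Real.pi - r)).scomp r e0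
      have e3 := e1.neg.prodMk e2
      have e4 : cubic lam (-clamp (√lam) (Y α (Real.pi - r)).1) =
          -cubic lam (clamp (√lam) (Y α (Real.pi - r)).1) := by unfold cubic; ring
      simp only [hF, clampedField, clamp_neg hk, e4, neg_neg] at e3 ⊢
      rw [neg_sub_left, neg_div, add_comm (Real.cos r)]
      exact e3
    · have : Real.pi - Real.pi / 2 = Real.pi / 2 := by ring
      rw [this]
      simp only at hmid
      ext <;> simp [hmid]
  -- The two reflections compose to antiperiodicity, so the absolute values are π-periodic.
  have hper : ∀ r, Y α (r + Real.pi) = (-(Y α r).1, -(Y α r).2) := by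
    intro r
    rw [← hodd (r + Real.pi), ← heven r]
    simp
  have hbd : ∀ r, |(Y α r).1| ≤ √lam ∧ |(Y α r).2| ≤ M := by
    have h1 : ∀ r ∈ Icc 0 Real.pi, |(Y α r).1| ≤ √lam ∧ |(Y α r).2| ≤ M := by
      intro r hr
      rcases le_total r (Real.pi / 2) with h | h
      · exact ⟨hR r ⟨hr.1, h⟩, hSb α r ⟨hr.1, h⟩⟩
      · have hm : Real.pi - r ∈ Icc 0 (Real.pi / 2) := ⟨by linarith [hr.2], by linarith⟩
        rw [← hodd r, abs_neg]
        exact ⟨hR _ hm, hSb α _ hm⟩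
    have p : Function.Periodic (fun r => (|(Y α r).1|, |(Y α r).2|)) Real.pi := by
      intro r; simp [hper]
    intro r
    obtain ⟨y, hy, hyr⟩ := p.exists_mem_Ico₀ Real.pi_pos r
    have h2 := h1 y ⟨hy.1, hy.2.le⟩
    rw [Prod.mk.injEq] at hyr
    rwa [hyr.1, hyr.2]
  refine ⟨fun r => ?_, fun r => ?_, ?_⟩
  · have := hd1 α r
    rwa [clamp_of_abs_le (hbd r).2] at this
  · have := hd2 α r
    rwa [clamp_of_abs_le (hbd r).1] at this
  · have := congrArg Prod.snd (hodd 0)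
    simpa [hY0] using this

/-! ### The lower branch of equilibria -/

theorem lambda0_pow_three : lambda0 ^ 3 = 27 / 4 := by
  unfold lambda0
  rw [div_pow, ← Real.rpow_natCast ((2 : ℝ) ^ ((2 : ℝ) / 3)) 3, ← Real.rpow_mul (by norm_num)]
  norm_num

theorem lambda0_pos : 0 < lambda0 := by unfold lambda0; positivity

theorem four_mul_pow_three_gt {lam : ℝ} (h : lambda0 < lam) : 27 < 4 * lam ^ 3 := by
  have := pow_lt_pow_left₀ h lambda0_pos.le three_ne_zero
  rw [lambda0_pow_three] at this
  linarith

/-- The left turning point `-√(λ/3)` of the cubic. -/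
noncomputable def turningPoint (lam : ℝ) : ℝ := -√(lam / 3)

theorem turningPoint_neg {lam : ℝ} (hlam : 0 < lam) : turningPoint lam < 0 :=
  neg_lt_zero.2 (Real.sqrt_pos.2 (by positivity))

theorem turningPoint_sq {lam : ℝ} (hlam : 0 < lam) : 3 * turningPoint lam ^ 2 = lam := by
  unfold turningPoint
  rw [neg_sq, Real.sq_sqrt (by positivity)]; ring

theorem neg_sqrt_lt_turningPoint {lam : ℝ} (hlam : 0 < lam) : -√lam < turningPoint lam :=
  neg_lt_neg (Real.sqrt_lt_sqrt (by positivity) (by linarith))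

theorem cubic_sub (lam v w : ℝ) :
    cubic lam v - cubic lam w = (v - w) * (v ^ 2 + v * w + w ^ 2 - lam) := by
  unfold cubic; ring

theorem strictMonoOn_cubic {lam : ℝ} (hlam : 0 < lam) :
    StrictMonoOn (cubic lam) (Iic (turningPoint lam)) := by
  intro v hv w hw hvw
  simp only [mem_Iic] at hv hw
  have h0 := turningPoint_neg hlam
  have h1 := turningPoint_sq hlam
  rw [← sub_pos, cubic_sub]
  apply mul_pos (by linarith)
  nlinarith [mul_nonneg (sub_nonneg.2 hv) (sub_nonneg.2 hw), mul_nonneg (sub_nonneg.2 hw) (neg_nonneg.2 h0.le),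
    mul_pos (show 0 < turningPoint lam - v by linarith) (show 0 < -turningPoint lam by linarith)]

/-- The local maximum of the cubic is 2(λ/3)^(3/2), which exceeds 1 exactly when 4λ³ > 27. This is
where the threshold λ₀ enters: since cos r ≤ 1, the smallest root never reaches the turning point.
-/
theorem one_lt_cubic_turningPoint {lam : ℝ} (hlam : lambda0 < lam) :
    1 < cubic lam (turningPoint lam) := by
  have hpos : 0 < lam := lambda0_pos.trans hlam
  have h0 := turningPoint_neg hpos
  have h1 := turningPoint_sq hpos
  have h2 := four_mul_pow_three_gt hlam
  set g := turningPoint lam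
  have h3 : cubic lam g = -2 * g ^ 3 := by unfold cubic; rw [← h1]; ring
  rw [h3]
  have h4 : 1 < (-2 * g ^ 3) ^ 2 := by
    rw [← h1] at h2; nlinarith
  have h5 : 0 < -2 * g ^ 3 := by
    have : 0 < (-g) ^ 3 := by apply pow_pos; linarith
    nlinarith
  nlinarith

/-- The lower branch of equilibria in the reversed time `r = π - t`. -/
noncomputable def lowerBranch (lam r : ℝ) : ℝ := Ulow lam (Real.pi - r)

theorem mem_rootSet_pi_sub {lam r v : ℝ} :
    v ∈ rootSet lam (Real.pi - r) ↔ cubic lam v = Real.cos r := by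
  simp only [rootSet, mem_ofPred_eq, Real.cos_pi_sub, cubic]
  constructor <;> intro h <;> linarith

theorem cubic_lowerBranch (lam r : ℝ) : cubic lam (lowerBranch lam r) = Real.cos r :=
  mem_rootSet_pi_sub.1 (Ulow_isLeast lam (Real.pi - r)).1

theorem lowerBranch_le {lam r v : ℝ} (h : cubic lam v = Real.cos r) : lowerBranch lam r ≤ v :=
  (Ulow_isLeast lam (Real.pi - r)).2 (mem_rootSet_pi_sub.2 h)

theorem lowerBranch_lt_turningPoint {lam : ℝ} (hlam : lambda0 < lam) (r : ℝ) :
    lowerBranch lam r < turningPoint lam := by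
  have hpos : 0 < lam := lambda0_pos.trans hlam
  have h0 := turningPoint_neg hpos
  have h1 := turningPoint_sq hpos
  have h2 := one_lt_cubic_turningPoint hlam
  have hle : -(lam + 2) ≤ turningPoint lam := by nlinarith
  have hc : ContinuousOn (cubic lam) (Icc (-(lam + 2)) (turningPoint lam)) := by
    unfold cubic; fun_prop
  have hlow : cubic lam (-(lam + 2)) ≤ -1 := by unfold cubic; nlinarith [pow_pos hpos 2, pow_pos hpos 3]
  obtain ⟨v, hv, hv'⟩ := intermediate_value_Icc hle hc
    (show Real.cos r ∈ Icc _ _ from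
      ⟨hlow.trans (Real.neg_one_le_cos r), (Real.cos_le_one r).trans h2.le⟩)
  refine lt_of_le_of_ne ((lowerBranch_le hv').trans hv.2) fun h => ?_
  have := cubic_lowerBranch lam r
  rw [h] at this
  linarith [Real.cos_le_one r]

theorem lt_lowerBranch_iff {lam : ℝ} (hlam : lambda0 < lam) {r v : ℝ} (hv : v ≤ turningPoint lam) :
    v < lowerBranch lam r ↔ cubic lam v < Real.cos r := by
  rw [← cubic_lowerBranch lam r]
  exact ((strictMonoOn_cubic (lambda0_pos.trans hlam)).lt_iff_lt hv
    (lowerBranch_lt_turningPoint hlam r).le).symm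

theorem lowerBranch_lt_iff {lam : ℝ} (hlam : lambda0 < lam) {r v : ℝ} (hv : v ≤ turningPoint lam) :
    lowerBranch lam r < v ↔ Real.cos r < cubic lam v := by
  rw [← cubic_lowerBranch lam r]
  exact ((strictMonoOn_cubic (lambda0_pos.trans hlam)).lt_iff_lt
    (lowerBranch_lt_turningPoint hlam r).le hv).symm

theorem cubic_neg_sqrt {lam : ℝ} (hlam : 0 < lam) : cubic lam (-√lam) = 0 := by
  have := Real.sq_sqrt hlam.le
  unfold cubic
  linear_combination (-√lam) * this

theorem neg_sqrt_le_lowerBranch {lam : ℝ} (hlam : lambda0 < lam) {r : ℝ} (hr : 0 ≤ Real.cos r) :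
    -√lam ≤ lowerBranch lam r := by
  have hpos : 0 < lam := lambda0_pos.trans hlam
  by_contra! h
  rw [lowerBranch_lt_iff hlam (neg_sqrt_lt_turningPoint hpos).le, cubic_neg_sqrt hpos] at h
  linarith

theorem neg_sqrt_lt_lowerBranch {lam : ℝ} (hlam : lambda0 < lam) {r : ℝ} (hr : 0 < Real.cos r) :
    -√lam < lowerBranch lam r := by
  have hpos : 0 < lam := lambda0_pos.trans hlam
  rwa [lt_lowerBranch_iff hlam (neg_sqrt_lt_turningPoint hpos).le, cubic_neg_sqrt hpos]

theorem lowerBranch_le_zero_time {lam : ℝ} (hlam : lambda0 < lam) (r : ℝ) :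
    lowerBranch lam r ≤ lowerBranch lam 0 := by
  by_contra! h
  rw [lt_lowerBranch_iff hlam (lowerBranch_lt_turningPoint hlam 0).le, cubic_lowerBranch,
    Real.cos_zero] at h
  linarith [Real.cos_le_one r]

theorem Ulow_pi_div_two {lam : ℝ} (hlam : lambda0 < lam) : Ulow lam (Real.pi / 2) = -√lam := by
  have hpos : 0 < lam := lambda0_pos.trans hlam
  have h1 : Ulow lam (Real.pi / 2) = lowerBranch lam (Real.pi / 2) := by
    unfold lowerBranch; congr 1; ring
  rw [h1]
  apply le_antisymm
  · exact lowerBranch_le (by rw [cubic_neg_sqrt hpos, Real.cos_pi_div_two])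
  · exact neg_sqrt_le_lowerBranch hlam (by simp)

theorem Ubar_pi_div_two {lam : ℝ} (hlam : lambda0 < lam) : Ubar lam (Real.pi / 2) = √lam := by
  have hpos : 0 < lam := lambda0_pos.trans hlam
  have hs := Real.sq_sqrt hpos.le
  have hk := Real.sqrt_pos.2 hpos
  obtain ⟨hm, hu⟩ := Ubar_isGreatest lam (Real.pi / 2)
  have h2 : √lam ≤ Ubar lam (Real.pi / 2) := by
    apply hu
    simp only [rootSet, mem_ofPred_eq, Real.cos_pi_div_two]
    linear_combination √lam * hs
  refine le_antisymm ?_ h2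
  simp only [rootSet, mem_ofPred_eq, Real.cos_pi_div_two] at hm
  have h3 : Ubar lam (Real.pi / 2) * (Ubar lam (Real.pi / 2) ^ 2 - √lam ^ 2) = 0 := by
    rw [hs]; linear_combination hm
  rcases mul_eq_zero.1 h3 with h | h
  · linarith
  · nlinarith

theorem exists_pos_slope_lowerBranch {lam : ℝ} (hlam : lambda0 < lam) (r : ℝ) :
    0 < 3 * lowerBranch lam r ^ 2 - lam := by
  have hpos : 0 < lam := lambda0_pos.trans hlam
  have h1 := turningPoint_sq hpos
  have h2 := turningPoint_neg hpos
  have h3 := lowerBranch_lt_turningPoint hlam r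
  nlinarith

/-- The branch is highest at r = 0, and to the left of that value the cubic has slope at least 3b² −
λ > 0; so the branch is a Lipschitz function of cos r. -/
theorem continuous_lowerBranch {lam : ℝ} (hlam : lambda0 < lam) : Continuous (lowerBranch lam) := by
  have hpos : 0 < lam := lambda0_pos.trans hlam
  set b := lowerBranch lam 0 with hb
  have hk : 0 < 3 * b ^ 2 - lam := exists_pos_slope_lowerBranch hlam 0
  have hb0 : b < 0 := (lowerBranch_lt_turningPoint hlam 0).trans (turningPoint_neg hpos)
  rw [continuous_iff_continuousAt]
  intro r
  rw [ContinuousAt, tendsto_iff_dist_tendsto_zero]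
  have hlim : Tendsto (fun s => |Real.cos s - Real.cos r| / (3 * b ^ 2 - lam)) (𝓝 r) (𝓝 0) := by
    have hc : Continuous fun s => |Real.cos s - Real.cos r| / (3 * b ^ 2 - lam) := by fun_prop
    simpa using hc.tendsto r
  refine squeeze_zero (fun _ => dist_nonneg) (fun s => ?_) hlim
  rw [Real.dist_eq, le_div_iff₀ hk, ← cubic_lowerBranch lam s, ← cubic_lowerBranch lam r,
    cubic_sub, abs_mul]
  apply mul_le_mul_of_nonneg_left _ (abs_nonneg _)
  refine le_trans ?_ (le_abs_self _)
  have h1 := lowerBranch_le_zero_time hlam s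
  have h2 := lowerBranch_le_zero_time hlam r
  rw [← hb] at h1 h2
  nlinarith [mul_nonneg (sub_nonneg.2 h1) (sub_nonneg.2 h2),
    mul_nonneg (sub_nonneg.2 h1) (neg_nonneg.2 hb0.le),
    mul_nonneg (sub_nonneg.2 h2) (neg_nonneg.2 hb0.le)]

theorem hasDerivAt_lowerBranch {lam : ℝ} (hlam : lambda0 < lam) (r : ℝ) :
    HasDerivAt (lowerBranch lam) (-Real.sin r / (3 * lowerBranch lam r ^ 2 - lam)) r := by
  have hpos : 0 < lam := lambda0_pos.trans hlam
  have hk := exists_pos_slope_lowerBranch hlam r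
  have hc := continuous_lowerBranch hlam
  have hcos := hasDerivAt_iff_tendsto_slope.1 (Real.hasDerivAt_cos r)
  rw [hasDerivAt_iff_tendsto_slope]
  have hQ : Tendsto (fun s => lowerBranch lam s ^ 2 + lowerBranch lam s * lowerBranch lam r + lowerBranch lam r ^ 2 - lam) (𝓝[≠] r)
      (𝓝 (3 * lowerBranch lam r ^ 2 - lam)) := by
    have : Continuous fun s => lowerBranch lam s ^ 2 + lowerBranch lam s * lowerBranch lam r + lowerBranch lam r ^ 2 - lam := by fun_prop
    have := (this.tendsto r).mono_left (nhdsWithin_le_nhds (s := {r}ᶜ))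
    convert this using 2
    ring
  refine (hcos.div hQ hk.ne').congr fun s => ?_
  have hs : 0 < lowerBranch lam s ^ 2 + lowerBranch lam s * lowerBranch lam r + lowerBranch lam r ^ 2 - lam := by
    have h0 := turningPoint_neg hpos
    have h1 := turningPoint_sq hpos
    have h2 := lowerBranch_lt_turningPoint hlam s
    have h3 := lowerBranch_lt_turningPoint hlam r
    nlinarith [mul_pos (sub_pos.2 h2) (sub_pos.2 h3), mul_pos (sub_pos.2 h2) (neg_pos.2 h0),
      mul_pos (sub_pos.2 h3) (neg_pos.2 h0)]
  rw [Pi.div_apply, slope_def_field, slope_def_field, ← cubic_lowerBranch lam s, ← cubic_lowerBranch lam r,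
    cubic_sub]
  rw [mul_div_right_comm, mul_div_cancel_right₀ _ hs.ne']

/-! ### One-sided consequences of a positive derivative, and first times -/

theorem eventually_gt_of_hasDerivAt_pos {f : ℝ → ℝ} {a x : ℝ} (h : HasDerivAt f a x) (ha : 0 < a) :
    ∀ᶠ y in 𝓝[>] x, f x < f y := by
  have h1 := (hasDerivAt_iff_tendsto_slope.1 h).eventually (lt_mem_nhds ha)
  have h2 : ∀ᶠ y in 𝓝[>] x, 0 < slope f x y :=
    h1.filter_mono (nhdsWithin_mono x fun y (hy : x < y) => hy.ne')
  filter_upwards [h2, self_mem_nhdsWithin] with y hy (hxy : x < y)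
  rw [slope_def_field] at hy
  have := (div_pos_iff_of_pos_right (sub_pos.2 hxy)).1 hy
  linarith

theorem eventually_lt_of_hasDerivAt_pos {f : ℝ → ℝ} {a x : ℝ} (h : HasDerivAt f a x) (ha : 0 < a) :
    ∀ᶠ y in 𝓝[<] x, f y < f x := by
  have h1 := (hasDerivAt_iff_tendsto_slope.1 h).eventually (lt_mem_nhds ha)
  have h2 : ∀ᶠ y in 𝓝[<] x, 0 < slope f x y :=
    h1.filter_mono (nhdsWithin_mono x fun y (hy : y < x) => hy.ne)
  filter_upwards [h2, self_mem_nhdsWithin] with y hy (hxy : y < x)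
  rw [slope_def_field] at hy
  by_contra! hc
  exact absurd (div_nonpos_of_nonneg_of_nonpos (sub_nonneg.2 hc) (sub_nonpos.2 hxy.le)) (not_le.2 hy)

theorem exists_first_nonneg {f : ℝ → ℝ} (hf : Continuous f) {a b : ℝ} (hab : a ≤ b)
    (hb : 0 ≤ f b) : ∃ c ∈ Icc a b, 0 ≤ f c ∧ ∀ x ∈ Ico a c, f x < 0 := by
  obtain ⟨c, hc⟩ := (isCompact_Icc.inter_right (isClosed_Ici.preimage hf) :
    IsCompact (Icc a b ∩ f ⁻¹' Ici 0)).exists_isLeast ⟨b, ⟨hab, le_rfl⟩, hb⟩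
  refine ⟨c, hc.1.1, hc.1.2, fun x hx => ?_⟩
  by_contra! h
  exact absurd (hc.2 ⟨⟨hx.1, hx.2.le.trans hc.1.1.2⟩, h⟩) (not_le.2 hx.2)

/-! ### Relative energy and trapping after the first critical point -/

/-- The potential of the frozen equation at reversed time `r`. -/
noncomputable def potential (lam r v : ℝ) : ℝ := (v ^ 2 - lam) ^ 2 / 4 - v * Real.cos r

/-- The lower branch is a critical point of the frozen potential, hence the double factor. The other
factor gives the sign of the gap at the first critical point and, later, a bound of speed by height.
-/
theorem potential_sub_lowerBranch (lam r v : ℝ) :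
    potential lam r v - potential lam r (lowerBranch lam r) = (v - lowerBranch lam r) ^ 2 *
      (v ^ 2 + 2 * v * lowerBranch lam r + 3 * lowerBranch lam r ^ 2 - 2 * lam) / 4 := by
  unfold potential
  rw [← cubic_lowerBranch lam r]
  unfold cubic
  ring

/-- The energy relative to the lower branch. -/
noncomputable def gap (lam ε : ℝ) (R S : ℝ → ℝ) (r : ℝ) : ℝ :=
  ε ^ 2 * S r ^ 2 / 2 - (potential lam r (R r) - potential lam r (lowerBranch lam r))

theorem cos_pos_of_mem {r : ℝ} (h0 : 0 ≤ r) (h1 : r < Real.pi / 2) : 0 < Real.cos r :=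
  Real.cos_pos_of_mem_Ioo ⟨by linarith [Real.pi_pos], h1⟩

section Shot

variable {lam ε α : ℝ} {R S : ℝ → ℝ}

theorem IsShot.antitoneOn (h : IsShot lam ε α R S) {a r : ℝ} (ha : 0 ≤ a) (hr : r ≤ Real.pi / 2)
    (hS : ∀ x ∈ Ioo a r, S x ≤ 0) : AntitoneOn R (Icc a r) := by
  refine antitoneOn_of_deriv_nonpos (convex_Icc a r) h.continuous_R.continuousOn ?_ ?_
  · intro x hx
    rw [interior_Icc] at hx
    exact (h.hasDerivAt_R x ⟨by linarith [hx.1], by linarith [hx.2]⟩).differentiableAt.differentiableWithinAt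
  · intro x hx
    rw [interior_Icc] at hx
    rw [(h.hasDerivAt_R x ⟨by linarith [hx.1], by linarith [hx.2]⟩).deriv]
    exact hS x hx

theorem IsShot.strictAntiOn (h : IsShot lam ε α R S) {a r : ℝ} (ha : 0 ≤ a) (hr : r ≤ Real.pi / 2)
    (hS : ∀ x ∈ Ioo a r, S x < 0) : StrictAntiOn R (Icc a r) := by
  refine strictAntiOn_of_deriv_neg (convex_Icc a r) h.continuous_R.continuousOn ?_
  intro x hx
  rw [interior_Icc] at hx
  rw [(h.hasDerivAt_R x ⟨by linarith [hx.1], by linarith [hx.2]⟩).deriv]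
  exact hS x hx

/-- A falling shot stays below α, left of the turning point. At or below −√λ the clamped cubic
vanishes and cos r > 0 would make the acceleration negative; to the right of −√λ, nonnegative
acceleration means lying on or above the branch. -/
theorem IsShot.bounds_of_accel_nonneg (h : IsShot lam ε α R S) (hlam : lambda0 < lam)
    (hα : α ≤ lowerBranch lam 0) {r : ℝ} (hr0 : 0 ≤ r) (hr : r < Real.pi / 2)
    (hS : ∀ x ∈ Ioo 0 r, S x ≤ 0)
    (hacc : Real.cos r ≤ cubic lam (clamp (√lam) (R r))) :
    -√lam < R r ∧ R r ≤ α ∧ lowerBranch lam r ≤ R r ∧ clamp (√lam) (R r) = R r := by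
  have hpos : 0 < lam := lambda0_pos.trans hlam
  have hk := Real.sqrt_pos.2 hpos
  have h1 : R r ≤ α := by
    rw [← h.R_zero]
    exact h.antitoneOn le_rfl hr.le hS ⟨le_rfl, hr0⟩ ⟨hr0, le_rfl⟩ hr0
  have h2 : -√lam < R r := by
    by_contra! hc
    have : clamp (√lam) (R r) = -√lam := by
      unfold clamp
      rw [min_eq_right (by linarith), max_eq_left hc]
    rw [this, cubic_neg_sqrt hpos] at hacc
    linarith [cos_pos_of_mem hr0 hr]
  have h3 := lowerBranch_lt_turningPoint hlam 0
  have h4 := turningPoint_neg hpos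
  have h5 : clamp (√lam) (R r) = R r := clamp_of_abs_le (abs_le.2 ⟨h2.le, by linarith⟩)
  refine ⟨h2, h1, ?_, h5⟩
  rw [h5] at hacc
  by_contra! hc
  rw [lt_lowerBranch_iff hlam (by linarith)] at hc
  linarith

/-- The drift of the lower branch: where `R` meets it with zero speed, `R - L` is increasing. -/
theorem IsShot.hasDerivAt_sub_lowerBranch (h : IsShot lam ε α R S) (hlam : lambda0 < lam) {r : ℝ}
    (hr : r ∈ Icc 0 (Real.pi / 2)) : HasDerivAt (fun r => R r - lowerBranch lam r)
      (S r + Real.sin r / (3 * lowerBranch lam r ^ 2 - lam)) r := by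
  have := (h.hasDerivAt_R r hr).sub (hasDerivAt_lowerBranch hlam r)
  rwa [neg_div, sub_neg_eq_add] at this

theorem sin_div_pos (hlam : lambda0 < lam) {r : ℝ} (h0 : 0 < r) (h1 : r ≤ Real.pi / 2) :
    0 < Real.sin r / (3 * lowerBranch lam r ^ 2 - lam) :=
  div_pos (Real.sin_pos_of_pos_of_lt_pi h0 (by linarith [Real.pi_pos]))
    (exists_pos_slope_lowerBranch hlam r)

/-- At its first critical point the shot lies strictly above the lower branch. -/
theorem IsShot.lowerBranch_lt_of_first_critical (h : IsShot lam ε α R S) (hlam : lambda0 < lam)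
    (hε : 0 < ε) (hα : α ≤ lowerBranch lam 0) {σ : ℝ} (hσ0 : 0 < σ) (hσ : σ < Real.pi / 2)
    (hS : ∀ x ∈ Ioo 0 σ, S x < 0) (hSσ : S σ = 0) :
    -√lam < R σ ∧ R σ ≤ α ∧ lowerBranch lam σ < R σ := by
  have hpos : 0 < lam := lambda0_pos.trans hlam
  -- The negative speed climbs to 0 at σ, so the acceleration there is nonnegative.
  have hacc : Real.cos σ ≤ cubic lam (clamp (√lam) (R σ)) := by
    by_contra! hc
    have hneg : 0 < -((cubic lam (clamp (√lam) (R σ)) - Real.cos σ) / ε ^ 2) := by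
      rw [← neg_div]; apply div_pos (by linarith) (by positivity)
    have h1 := eventually_lt_of_hasDerivAt_pos (h.hasDerivAt_S σ).neg hneg
    have h2 : ∀ᶠ y in 𝓝[<] σ, y ∈ Ioo 0 σ := Ioo_mem_nhdsLT hσ0
    obtain ⟨y, hy1, hy2⟩ := (h1.and h2).exists
    simp only [Pi.neg_apply, hSσ] at hy1
    linarith [hS y hy2]
  obtain ⟨b1, b2, b3, -⟩ := h.bounds_of_accel_nonneg hlam hα hσ0.le hσ (fun x hx => (hS x hx).le) hacc
  refine ⟨b1, b2, lt_of_le_of_ne b3 fun heq => ?_⟩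
  -- If R met the falling branch at σ with zero speed, R would lie strictly below it just before σ.
  -- But S increases to 0 there, so some nearby point has positive acceleration and hence lies on or
  -- above the branch.
  have hw := h.hasDerivAt_sub_lowerBranch hlam ⟨hσ0.le, hσ.le⟩
  rw [hSσ, zero_add] at hw
  have h1 := eventually_lt_of_hasDerivAt_pos hw (sin_div_pos hlam hσ0 hσ.le)
  have h2 : ∀ᶠ y in 𝓝[<] σ, y ∈ Ioo 0 σ := Ioo_mem_nhdsLT hσ0
  obtain ⟨l, hl, hsub⟩ := (mem_nhdsLT_iff_exists_Ioo_subset).1 (h1.and h2)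
  have hl : l < σ := hl
  have hmid : (l + σ) / 2 ∈ Ioo l σ := ⟨by linarith, by linarith⟩
  obtain ⟨ξ, hξ, hξ'⟩ := exists_hasDerivAt_eq_slope S _ hmid.2 h.continuous_S.continuousOn
    (fun x _ => h.hasDerivAt_S x)
  obtain ⟨hw1, hw2⟩ := hsub ⟨hmid.1.trans hξ.1, hξ.2⟩
  have hy := (hsub hmid).2
  have hslope : 0 < (S σ - S ((l + σ) / 2)) / (σ - (l + σ) / 2) :=
    div_pos (by linarith [hS _ hy]) (by linarith)
  rw [← hξ'] at hslope
  have hcos := (div_pos_iff_of_pos_right (by positivity : 0 < ε ^ 2)).1 hslope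
  obtain ⟨-, -, c3, -⟩ := h.bounds_of_accel_nonneg hlam hα hw2.1.le (hw2.2.trans hσ)
    (fun x hx => (hS x ⟨hx.1, hx.2.trans hw2.2⟩).le) (by linarith)
  linarith

/-- The equation of motion cancels the frozen part and the branch is critical for the potential, so
only the explicit dependence on cos r contributes. -/
theorem IsShot.hasDerivAt_gap (h : IsShot lam ε α R S) (hlam : lambda0 < lam) (hε : 0 < ε) {r : ℝ}
    (hr : r ∈ Icc 0 (Real.pi / 2)) (hR : |R r| ≤ √lam) :
    HasDerivAt (gap lam ε R S) (-((R r - lowerBranch lam r) * Real.sin r)) r := by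
  have hR' := h.hasDerivAt_R r hr
  have hS' := h.hasDerivAt_S r
  have hL' := hasDerivAt_lowerBranch hlam r
  rw [clamp_of_abs_le hR] at hS'
  have hc := cubic_lowerBranch lam r
  have hp : ∀ {f : ℝ → ℝ} {f' : ℝ}, HasDerivAt f f' r → HasDerivAt (fun r => potential lam r (f r))
      ((cubic lam (f r) - Real.cos r) * f' + f r * Real.sin r) r := by
    intro f f' hf
    have := ((((hf.pow 2).sub_const lam).pow 2).div_const 4).sub (hf.mul (Real.hasDerivAt_cos r))
    refine this.congr_deriv ?_
    simp only [Pi.pow_apply, cubic]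
    push_cast
    ring
  have := (((hS'.pow 2).const_mul (ε ^ 2)).div_const 2).sub ((hp hR').sub (hp hL'))
  refine this.congr_deriv ?_
  rw [hc]
  push_cast
  field_simp
  ring

theorem IsShot.gap_antitone (h : IsShot lam ε α R S) (hlam : lambda0 < lam) (hε : 0 < ε)
    {a c : ℝ} (ha : 0 ≤ a) (hc : c ≤ Real.pi / 2) (hac : a ≤ c)
    (hR : ∀ r ∈ Ioo a c, lowerBranch lam r < R r ∧ R r < √lam) :
    gap lam ε R S c ≤ gap lam ε R S a := by
  have hcont : Continuous (gap lam ε R S) := by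
    have h1 := h.continuous_R
    have h2 := h.continuous_S
    have h3 := continuous_lowerBranch hlam
    unfold gap potential
    fun_prop
  have hd : ∀ r ∈ Ioo a c, HasDerivAt (gap lam ε R S) (-((R r - lowerBranch lam r) * Real.sin r)) r := by
    intro r hr
    have hr' : r ∈ Icc 0 (Real.pi / 2) := ⟨by linarith [hr.1], by linarith [hr.2]⟩
    apply h.hasDerivAt_gap hlam hε hr'
    have h1 := neg_sqrt_le_lowerBranch hlam (r := r)
      (Real.cos_nonneg_of_mem_Icc ⟨by linarith [Real.pi_pos, hr'.1], hr'.2⟩)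
    have := hR r hr
    exact abs_le.2 ⟨by linarith, by linarith⟩
  refine antitoneOn_of_deriv_nonpos (convex_Icc a c) hcont.continuousOn ?_ ?_ ⟨le_rfl, hac⟩
    ⟨hac, le_rfl⟩ hac
  · rw [interior_Icc]
    exact fun x hx => (hd x hx).differentiableAt.differentiableWithinAt
  · rw [interior_Icc]
    intro x hx
    rw [(hd x hx).deriv, neg_nonpos]
    exact mul_nonneg (by linarith [(hR x hx).1])
      (Real.sin_nonneg_of_nonneg_of_le_pi (by linarith [hx.1]) (by linarith [hx.2, Real.pi_pos]))

/-- After the first critical point the shot is trapped. -/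
theorem IsShot.trapped (h : IsShot lam ε α R S) (hlam : lambda0 < lam) (hε : 0 < ε)
    (hα : α ≤ lowerBranch lam 0) {σ : ℝ} (hσ0 : 0 < σ) (hσ : σ < Real.pi / 2)
    (hS : ∀ x ∈ Ioo 0 σ, S x < 0) (hSσ : S σ = 0) :
    ∀ r ∈ Icc σ (Real.pi / 2), lowerBranch lam r < R r ∧ R r < √lam ∧ gap lam ε R S r < 0 := by
  have hpos : 0 < lam := lambda0_pos.trans hlam
  have hk := Real.sqrt_pos.2 hpos
  have hL := continuous_lowerBranch hlam
  have hRc := h.continuous_R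
  obtain ⟨b1, b2, b3⟩ := h.lowerBranch_lt_of_first_critical hlam hε hα hσ0 hσ hS hSσ
  have ht0 := turningPoint_neg hpos
  have ht := lowerBranch_lt_turningPoint hlam 0
  -- With S = 0 the gap is minus the potential difference. Both R(σ) and L(σ) lie left of the
  -- turning point g, so the second factor exceeds 6g² − 2λ = 0.
  have hgσ : gap lam ε R S σ < 0 := by
    unfold gap
    rw [hSσ, potential_sub_lowerBranch]
    have h1 := turningPoint_sq hpos
    have h2 := lowerBranch_lt_turningPoint hlam σ
    have h3 : R σ < turningPoint lam := by linarith
    have h4 : 0 < R σ ^ 2 + 2 * R σ * lowerBranch lam σ + 3 * lowerBranch lam σ ^ 2 - 2 * lam := by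
      nlinarith [mul_pos (sub_pos.2 h2) (sub_pos.2 h3), mul_pos (sub_pos.2 h2) (neg_pos.2 ht0),
        mul_pos (sub_pos.2 h3) (neg_pos.2 ht0)]
    have h5 : 0 < (R σ - lowerBranch lam σ) ^ 2 := pow_pos (sub_pos.2 b3) 2
    have := mul_pos h5 h4
    linarith
  have key : ∀ r ∈ Icc σ (Real.pi / 2), lowerBranch lam r < R r ∧ R r < √lam := by
    by_contra! hne
    obtain ⟨r₀, hr₀, hr₀'⟩ := hne
    have hcl : IsClosed {r | R r ≤ lowerBranch lam r ∨ √lam ≤ R r} :=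
      (isClosed_le hRc hL).union (isClosed_le continuous_const hRc)
    obtain ⟨c, hc, hmin⟩ := (isCompact_Icc.inter_right hcl).exists_isLeast
      (⟨r₀, hr₀, (le_or_gt (R r₀) _).imp id hr₀'⟩ :
        (Icc σ (Real.pi / 2) ∩ {r | R r ≤ lowerBranch lam r ∨ √lam ≤ R r}).Nonempty)
    have hin : ∀ r ∈ Ico σ c, lowerBranch lam r < R r ∧ R r < √lam := by
      intro r hr
      by_contra hcon
      rw [not_and_or, not_lt, not_lt] at hcon
      exact absurd (hmin ⟨⟨hr.1, hr.2.le.trans hc.1.2⟩, hcon⟩) (not_le.2 hr.2)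
    have hg := h.gap_antitone hlam hε hσ0.le hc.1.2 hc.1.1 fun r hr => hin r ⟨hr.1.le, hr.2⟩
    have hgc : gap lam ε R S c < 0 := lt_of_le_of_lt hg hgσ
    have hσc : σ < c := by
      refine lt_of_le_of_ne hc.1.1 fun heq => ?_
      rcases hc.2 with h1 | h1 <;> rw [← heq] at h1 <;> linarith
    have hcosc : 0 ≤ Real.cos c :=
      Real.cos_nonneg_of_mem_Icc ⟨by linarith [Real.pi_pos], hc.1.2⟩
    have hle1 : lowerBranch lam c ≤ R c :=
      ge_of_tendsto ((hRc.sub hL).continuousWithinAt (s := Iio c) (x := c) |>.tendsto)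
        (show ∀ᶠ r in 𝓝[<] c, 0 ≤ R r - lowerBranch lam r by
          filter_upwards [Ioo_mem_nhdsLT hσc] with r hr
          linarith [(hin r ⟨hr.1.le, hr.2⟩).1]) |> sub_nonneg.1
    have hle2 : R c ≤ √lam :=
      le_of_tendsto (hRc.continuousWithinAt (s := Iio c) (x := c) |>.tendsto)
        (by filter_upwards [Ioo_mem_nhdsLT hσc] with r hr
            exact (hin r ⟨hr.1.le, hr.2⟩).2.le)
    -- At the first exit time `c` the gap would be nonnegative: on the branch the potential
    -- difference is 0, and at √λ the potential is −√λ cos c ≤ 0 while on the branch it is at least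
    -- 0.
    unfold gap at hgc
    have hsq : 0 ≤ ε ^ 2 * S c ^ 2 / 2 := by positivity
    rcases hc.2 with h1 | h1
    · rw [le_antisymm h1 hle1] at hgc
      linarith
    · rw [le_antisymm hle2 h1] at hgc
      have hl0 : lowerBranch lam c < 0 := (lowerBranch_lt_turningPoint hlam c).trans ht0
      have e1 : potential lam c (√lam) = -(√lam * Real.cos c) := by
        unfold potential; rw [Real.sq_sqrt hpos.le]; ring
      have e2 : 0 ≤ potential lam c (lowerBranch lam c) := by
        unfold potential
        nlinarith [mul_nonneg (neg_nonneg.2 hl0.le) hcosc,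
          sq_nonneg (lowerBranch lam c ^ 2 - lam)]
      nlinarith [mul_nonneg hk.le hcosc]
  intro r hr
  refine ⟨(key r hr).1, (key r hr).2, lt_of_le_of_lt ?_ hgσ⟩
  exact h.gap_antitone hlam hε hσ0.le hr.2 hr.1 fun x hx => key x ⟨hx.1.le, hx.2.le.trans hr.2⟩

end Shot

/-! ### Energy of shots whose first critical point is close to π/2 -/

/-- Subtracting the parabola A x²/2 leaves a convex function, and midpoint convexity gives A(b −
a)²/8 ≤ 2k. It excludes long windows of definite acceleration for a bounded shot. -/
theorem second_deriv_mul_sq_le {f g g' : ℝ → ℝ} {a b A k : ℝ} (hab : a ≤ b)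
    (hf : ∀ x ∈ Icc a b, HasDerivAt f (g x) x) (hg : ∀ x ∈ Ioo a b, HasDerivAt g (g' x) x)
    (hA : ∀ x ∈ Ioo a b, A ≤ g' x) (hk : ∀ x ∈ Icc a b, |f x| ≤ k) :
    A * (b - a) ^ 2 ≤ 16 * k := by
  have hconv : ConvexOn ℝ (Icc a b) fun x => f x - A / 2 * x ^ 2 := by
    refine convexOn_of_hasDerivWithinAt2_nonneg (convex_Icc a b) (f' := fun x => g x - A * x)
      (f'' := fun x => g' x - A) ?_ ?_ ?_ ?_
    · exact (HasDerivAt.continuousOn hf).sub (by fun_prop)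
    · intro x hx
      rw [interior_Icc] at hx
      have h1 := (hf x (Ioo_subset_Icc_self hx)).sub (((hasDerivAt_id x).pow 2).const_mul (A / 2))
      refine (h1.congr_deriv ?_).hasDerivWithinAt
      simp; ring
    · intro x hx
      rw [interior_Icc] at hx
      have h1 := (hg x hx).sub ((hasDerivAt_id x).const_mul A)
      exact (h1.congr_deriv (by simp)).hasDerivWithinAt
    · intro x hx
      rw [interior_Icc] at hx
      linarith [hA x hx]
  have ha : a ∈ Icc a b := ⟨le_rfl, hab⟩
  have hb : b ∈ Icc a b := ⟨hab, le_rfl⟩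
  have hm := hconv.2 ha hb (show (0 : ℝ) ≤ 1 / 2 by norm_num) (show (0 : ℝ) ≤ 1 / 2 by norm_num)
    (by norm_num)
  simp only [smul_eq_mul] at hm
  have hc : 1 / 2 * a + 1 / 2 * b ∈ Icc a b := ⟨by linarith, by linarith⟩
  have e1 := abs_le.1 (hk a ha)
  have e2 := abs_le.1 (hk b hb)
  have e3 := abs_le.1 (hk _ hc)
  nlinarith

theorem cos_le_pi_div_two_sub {r : ℝ} (hr : r ≤ Real.pi / 2) : Real.cos r ≤ Real.pi / 2 - r := by
  rw [← Real.sin_pi_div_two_sub]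
  exact Real.sin_le (by linarith)

/-- Bound for the loss of energy of a shot whose first critical point is within `δ` of `π/2`. -/
noncomputable def energyDefect (lam δ : ℝ) : ℝ := 36 * δ ^ 2 / lam + 3 * √lam * δ

/-- After its first critical point `σ`, the shot stays in the well between the lower branch and
`√λ`, with autonomous energy at least `-e`. -/
structure IsTrapped (lam ε e : ℝ) (R S : ℝ → ℝ) (σ : ℝ) : Prop where
  pos : 0 < σ
  lt : σ < Real.pi / 2
  S_neg : ∀ x ∈ Ioo 0 σ, S x < 0
  S_eq : S σ = 0
  R_lower : -√lam < R σ
  R_neg : R σ < 0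
  lower : ∀ r ∈ Icc σ (Real.pi / 2), lowerBranch lam r < R r
  upper : ∀ r ∈ Icc σ (Real.pi / 2), R r < √lam
  gap_neg : ∀ r ∈ Icc σ (Real.pi / 2), gap lam ε R S r < 0
  energy : ∀ r ∈ Icc σ (Real.pi / 2), -e ≤ ε ^ 2 * S r ^ 2 / 2 - (R r ^ 2 - lam) ^ 2 / 4

section Shot

variable {lam ε α e σ : ℝ} {R S : ℝ → ℝ}

theorem IsTrapped.abs_le (ht : IsTrapped lam ε e R S σ) (hlam : lambda0 < lam) {r : ℝ}
    (hr : r ∈ Icc σ (Real.pi / 2)) : |R r| ≤ √lam := by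
  have h1 := neg_sqrt_le_lowerBranch hlam (r := r)
    (Real.cos_nonneg_of_mem_Icc ⟨by linarith [Real.pi_pos, hr.1, ht.pos], hr.2⟩)
  exact _root_.abs_le.2 ⟨by linarith [ht.lower r hr], (ht.upper r hr).le⟩

/-- Otherwise, on (π/2 − 2δ, π/2 − δ), where the shot is still falling, the cubic is at least 3δ and
cos r is at most 2δ. Then ε²R'' ≥ δ for a time δ, too much for |R| ≤ √λ when 16√λ ε² < δ³. -/
theorem IsShot.near_lowerBranch (h : IsShot lam ε α R S) (hlam : lambda0 < lam) (hε : 0 < ε)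
    (hα : α ≤ lowerBranch lam 0) {δ : ℝ} (hδ : 0 < δ) (hδ' : δ ≤ Real.pi / 4)
    (hεδ : 16 * √lam * ε ^ 2 < δ ^ 3) (hσ : Real.pi / 2 - δ ≤ σ) (hσ' : σ < Real.pi / 2)
    (hS : ∀ x ∈ Ioo 0 σ, S x < 0) (hSσ : S σ = 0) : R σ < -√lam + 6 * δ / lam := by
  have hpos : 0 < lam := lambda0_pos.trans hlam
  have hk := Real.sqrt_pos.2 hpos
  have hk2 := Real.sq_sqrt hpos.le
  have hpi := Real.pi_pos
  have hσ0 : 0 < σ := by linarith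
  obtain ⟨b1, b2, b3⟩ := h.lowerBranch_lt_of_first_critical hlam hε hα hσ0 hσ' hS hSσ
  have ht0 := turningPoint_neg hpos
  have ht1 := turningPoint_sq hpos
  have ht := lowerBranch_lt_turningPoint hlam 0
  by_contra! hc
  have hanti := h.strictAntiOn le_rfl hσ'.le hS
  have hR : ∀ r ∈ Icc 0 σ, R σ ≤ R r ∧ R r < turningPoint lam := by
    intro r hr
    refine ⟨hanti.antitoneOn hr ⟨hσ0.le, le_rfl⟩ hr.2, ?_⟩
    have := hanti.antitoneOn ⟨le_rfl, hσ0.le⟩ hr hr.1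
    rw [h.R_zero] at this
    linarith
  have habs : ∀ r ∈ Icc 0 σ, |R r| ≤ √lam := fun r hr =>
    abs_le.2 ⟨by linarith [hR r hr], by linarith [hR r hr]⟩
  have key := second_deriv_mul_sq_le (f := R) (g := S) (A := δ / ε ^ 2) (k := √lam)
    (a := Real.pi / 2 - 2 * δ) (b := Real.pi / 2 - δ) (by linarith)
    (fun x hx => h.hasDerivAt_R x ⟨by linarith [hx.1], by linarith [hx.2]⟩)
    (fun x _ => h.hasDerivAt_S x) ?_ (fun x hx => habs x ⟨by linarith [hx.1], by linarith [hx.2]⟩)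
  · have e : δ / ε ^ 2 * (Real.pi / 2 - δ - (Real.pi / 2 - 2 * δ)) ^ 2 = δ ^ 3 / ε ^ 2 := by ring
    rw [e, div_le_iff₀ (by positivity)] at key
    linarith
  · intro r hr
    have hr' : r ∈ Icc 0 σ := ⟨by linarith [hr.1], by linarith [hr.2]⟩
    apply div_le_div_of_nonneg_right _ (sq_nonneg ε)
    rw [clamp_of_abs_le (habs r hr')]
    have hcos := cos_le_pi_div_two_sub (r := r) (by linarith [hr.2])
    obtain ⟨h1, h2⟩ := hR r hr'
    have hhalf : √lam / 2 ≤ -R r := by nlinarith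
    have hprod : √lam * (6 * δ / lam) ≤ lam - R r ^ 2 := by
      have : √lam * (6 * δ / lam) ≤ (√lam - R r) * (R r + √lam) :=
        mul_le_mul (by linarith) (by linarith) (by positivity) (by linarith)
      nlinarith
    have h3 : √lam / 2 * (√lam * (6 * δ / lam)) ≤ -R r * (lam - R r ^ 2) :=
      mul_le_mul hhalf hprod (by positivity) (by linarith)
    have h4 : √lam / 2 * (√lam * (6 * δ / lam)) = 3 * δ := by
      have : √lam / 2 * (√lam * (6 * δ / lam)) = √lam ^ 2 / lam * (3 * δ) := by ring
      rw [this, hk2, div_self hpos.ne', one_mul]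
    have h5 : cubic lam (R r) = -R r * (lam - R r ^ 2) := by unfold cubic; ring
    rw [h5]
    linarith [hr.1]

theorem IsShot.isTrapped (h : IsShot lam ε α R S) (hlam : lambda0 < lam) (hε : 0 < ε)
    (hα : α ≤ lowerBranch lam 0) {δ : ℝ} (hδ : 0 < δ) (hδ' : δ ≤ Real.pi / 4)
    (hεδ : 16 * √lam * ε ^ 2 < δ ^ 3) (hσ : Real.pi / 2 - δ ≤ σ) (hσ' : σ < Real.pi / 2)
    (hS : ∀ x ∈ Ioo 0 σ, S x < 0) (hSσ : S σ = 0) :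
    IsTrapped lam ε (energyDefect lam δ) R S σ := by
  have hpos : 0 < lam := lambda0_pos.trans hlam
  have hk := Real.sqrt_pos.2 hpos
  have hk2 := Real.sq_sqrt hpos.le
  have hpi := Real.pi_pos
  have hσ0 : 0 < σ := by linarith
  obtain ⟨b1, b2, b3⟩ := h.lowerBranch_lt_of_first_critical hlam hε hα hσ0 hσ' hS hSσ
  have hnear := h.near_lowerBranch hlam hε hα hδ hδ' hεδ hσ hσ' hS hSσ
  have htrap := h.trapped hlam hε hα hσ0 hσ' hS hSσ
  have ht0 := turningPoint_neg hpos
  have ht := lowerBranch_lt_turningPoint hlam 0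
  have habs : ∀ r ∈ Icc σ (Real.pi / 2), |R r| ≤ √lam := by
    intro r hr
    have h1 := neg_sqrt_le_lowerBranch hlam (r := r)
      (Real.cos_nonneg_of_mem_Icc ⟨by linarith [hr.1], hr.2⟩)
    exact abs_le.2 ⟨by linarith [htrap r hr], (htrap r hr).2.1.le⟩
  refine ⟨hσ0, hσ', hS, hSσ, b1, by linarith, fun r hr => (htrap r hr).1,
    fun r hr => (htrap r hr).2.1, fun r hr => (htrap r hr).2.2, fun r hr => ?_⟩
  -- H' = −R sin r. The boundary terms R cos r at σ and r and the integral of H' each cost at most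
  -- √λ δ; the potential at σ costs at most 36δ²/λ. These add up to `energyDefect`.
  set H : ℝ → ℝ := fun r => ε ^ 2 * S r ^ 2 / 2 - (R r ^ 2 - lam) ^ 2 / 4 + R r * Real.cos r with hH
  have hd : ∀ x ∈ Icc σ (Real.pi / 2), HasDerivAt H (-(R x * Real.sin x)) x := by
    intro x hx
    have hR' := h.hasDerivAt_R x ⟨by linarith [hx.1], hx.2⟩
    have hS' := h.hasDerivAt_S x
    rw [clamp_of_abs_le (habs x hx)] at hS'
    have := ((((hS'.pow 2).const_mul (ε ^ 2)).div_const 2).sub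
      ((((hR'.pow 2).sub_const lam).pow 2).div_const 4)).add (hR'.mul (Real.hasDerivAt_cos x))
    refine this.congr_deriv ?_
    simp only [Pi.pow_apply, cubic]
    push_cast
    field_simp
    ring
  have hbd : ∀ x ∈ Icc σ (Real.pi / 2), |R x * Real.cos x| ≤ √lam * δ := by
    intro x hx
    rw [abs_mul]
    refine mul_le_mul (habs x hx) ?_ (abs_nonneg _) hk.le
    rw [abs_of_nonneg (Real.cos_nonneg_of_mem_Icc ⟨by linarith [hx.1], hx.2⟩)]
    linarith [cos_le_pi_div_two_sub hx.2, hx.1]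
  have hσm : σ ∈ Icc σ (Real.pi / 2) := ⟨le_rfl, hσ'.le⟩
  have hdiff := (convex_Icc σ (Real.pi / 2)).norm_image_sub_le_of_norm_hasDerivWithin_le
    (f := H) (C := √lam) (fun x hx => (hd x hx).hasDerivWithinAt) (fun x hx => by
      rw [norm_neg, norm_mul, Real.norm_eq_abs, Real.norm_eq_abs]
      simpa using mul_le_mul (habs x hx) (Real.abs_sin_le_one x) (abs_nonneg _) hk.le) hσm hr
  rw [Real.norm_eq_abs, Real.norm_eq_abs, abs_of_nonneg (sub_nonneg.2 hr.1)] at hdiff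
  have hdiff2 := (abs_le.1 (hdiff.trans
    (mul_le_mul_of_nonneg_left (by linarith [hr.2] : r - σ ≤ δ) hk.le))).1
  have e1 := (abs_le.1 (hbd r hr)).2
  have e2 := (abs_le.1 (hbd σ hσm)).1
  have e3 : (R σ ^ 2 - lam) ^ 2 / 4 ≤ 36 * δ ^ 2 / lam := by
    have h1 : lam - R σ ^ 2 ≤ 2 * √lam * (6 * δ / lam) := by
      have : (√lam - R σ) * (R σ + √lam) ≤ (2 * √lam) * (6 * δ / lam) :=
        mul_le_mul (by linarith) (by linarith) (by linarith) (by positivity)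
      nlinarith
    have h2 : 0 ≤ lam - R σ ^ 2 := by nlinarith
    have h3 : (lam - R σ ^ 2) ^ 2 ≤ (2 * √lam * (6 * δ / lam)) ^ 2 := pow_le_pow_left₀ h2 h1 2
    have h4 : (2 * √lam * (6 * δ / lam)) ^ 2 = 4 * (36 * δ ^ 2 / lam) := by
      rw [mul_pow, mul_pow, hk2]; field_simp; norm_num
    rw [h4] at h3
    nlinarith
  have e4 : H σ = -((R σ ^ 2 - lam) ^ 2 / 4) + R σ * Real.cos σ := by
    simp only [hH, hSσ]; ring
  rw [e4] at hdiff2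
  simp only [hH] at hdiff2
  unfold energyDefect
  linarith

/-- When R² ≤ λ/2 the term (R² − λ)²/4 is at least λ²/16, and the defect e uses up at most half of
it. -/
theorem IsTrapped.le_abs_S_of_abs_R_le (ht : IsTrapped lam ε e R S σ) (hlam : 0 < lam) (hε : 0 < ε)
    (he : e ≤ lam ^ 2 / 32) {r : ℝ} (hr : r ∈ Icc σ (Real.pi / 2)) (hR : R r ^ 2 ≤ lam / 2) :
    lam / (4 * ε) ≤ |S r| := by
  have h1 := ht.energy r hr
  have h2 : lam ^ 2 / 16 ≤ (R r ^ 2 - lam) ^ 2 / 4 := by nlinarith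
  rw [← abs_of_pos (show 0 < lam / (4 * ε) by positivity), ← sq_le_sq, div_pow,
    div_le_iff₀ (by positivity)]
  nlinarith

theorem IsTrapped.S_ne_zero (ht : IsTrapped lam ε e R S σ) (hlam : 0 < lam) (hε : 0 < ε)
    (he : e ≤ lam ^ 2 / 32) {r : ℝ} (hr : r ∈ Icc σ (Real.pi / 2)) (hR : R r = 0) :
    S r ≠ 0 := by
  have h1 := ht.le_abs_S_of_abs_R_le hlam hε he hr (by rw [hR]; linarith)
  have h2 : 0 < lam / (4 * ε) := by positivity
  intro h
  rw [h, abs_zero] at h1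
  linarith

theorem IsTrapped.sq_le_of_S_eq_zero (ht : IsTrapped lam ε e R S σ) {r : ℝ}
    (hr : r ∈ Icc σ (Real.pi / 2)) (hS : S r = 0) : (R r ^ 2 - lam) ^ 2 ≤ 4 * e := by
  have h1 := ht.energy r hr
  rw [hS] at h1
  linarith

/-- At a critical point the speed bound forces R² > λ/2 > λ/3, so a negative R lies left of the
turning point, where being above the branch means positive acceleration. -/
theorem IsTrapped.accel_pos (ht : IsTrapped lam ε e R S σ) (hlam : lambda0 < lam) (hε : 0 < ε)
    (he : e ≤ lam ^ 2 / 32) {r : ℝ} (hr : r ∈ Icc σ (Real.pi / 2)) (hS : S r = 0) (hR : R r < 0) :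
    0 < (cubic lam (clamp (√lam) (R r)) - Real.cos r) / ε ^ 2 := by
  have hpos : 0 < lam := lambda0_pos.trans hlam
  rw [clamp_of_abs_le (ht.abs_le hlam hr)]
  have h1 : lam / 2 < R r ^ 2 := by
    by_contra! hc
    have h2 := ht.le_abs_S_of_abs_R_le hpos hε he hr hc
    rw [hS, abs_zero] at h2
    have : 0 < lam / (4 * ε) := by positivity
    linarith
  have h2 : R r < turningPoint lam := by
    have := turningPoint_sq hpos
    have := turningPoint_neg hpos
    nlinarith
  have h3 := (lowerBranch_lt_iff hlam h2.le).1 (ht.lower r hr)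
  exact div_pos (by linarith) (by positivity)

theorem IsTrapped.accel_neg (ht : IsTrapped lam ε e R S σ) (hlam : lambda0 < lam) (hε : 0 < ε)
    {r : ℝ} (hr : r ∈ Icc σ (Real.pi / 2)) (hR : 0 < R r) :
    (cubic lam (clamp (√lam) (R r)) - Real.cos r) / ε ^ 2 < 0 := by
  have hpos : 0 < lam := lambda0_pos.trans hlam
  have hk2 := Real.sq_sqrt hpos.le
  rw [clamp_of_abs_le (ht.abs_le hlam hr)]
  have h1 := ht.upper r hr
  have h2 : cubic lam (R r) < 0 := by
    have : cubic lam (R r) = -(R r * (lam - R r ^ 2)) := by unfold cubic; ring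
    rw [this, neg_lt_zero]
    exact mul_pos hR (by nlinarith)
  have h3 : 0 ≤ Real.cos r :=
    Real.cos_nonneg_of_mem_Icc ⟨by linarith [Real.pi_pos, hr.1, ht.pos], hr.2⟩
  exact div_neg_of_neg_of_pos (by linarith) (by positivity)

end Shot

/-! ### Zeros in every time window -/

theorem pos_of_no_zero {f : ℝ → ℝ} {s : Set ℝ} (hs : IsPreconnected s) (hf : ContinuousOn f s)
    (h0 : ∀ x ∈ s, f x ≠ 0) {x₀ : ℝ} (hx₀ : x₀ ∈ s) (hpos : 0 < f x₀) : ∀ x ∈ s, 0 < f x := by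
  intro x hx
  by_contra! hc
  obtain ⟨y, hy, hy0⟩ := hs.intermediate_value hx hx₀ hf ⟨hc, hpos.le⟩
  exact h0 y hy hy0

/-- If `f' = g` is bounded away from zero wherever `f` exceeds its initial value, and `g` starts
out positive, then `f` grows at least linearly. -/
theorem mul_sub_le_of_speed {f g : ℝ → ℝ} {x y c : ℝ} (hc : 0 < c) (hxy : x ≤ y)
    (hf : ∀ r ∈ Icc x y, HasDerivAt f (g r) r) (hg : Continuous g)
    (hspeed : ∀ r ∈ Icc x y, f x ≤ f r → c ≤ |g r|) (hgx : 0 < g x) :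
    c * (y - x) ≤ f y - f x := by
  have hmono : ∀ z ∈ Icc x y, (∀ r ∈ Ico x z, 0 < g r) → MonotoneOn f (Icc x z) := by
    intro z hz hpos
    refine monotoneOn_of_deriv_nonneg (convex_Icc x z) ?_ ?_ ?_
    · exact HasDerivAt.continuousOn fun r hr => hf r ⟨hr.1, hr.2.trans hz.2⟩
    · rw [interior_Icc]
      exact fun r hr => (hf r ⟨hr.1.le, hr.2.le.trans hz.2⟩).differentiableAt.differentiableWithinAt
    · rw [interior_Icc]
      intro r hr
      rw [(hf r ⟨hr.1.le, hr.2.le.trans hz.2⟩).deriv]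
      exact (hpos r ⟨hr.1.le, hr.2⟩).le
  have hpos : ∀ r ∈ Icc x y, 0 < g r := by
    intro r hr
    by_contra! hcon
    -- Up to the first time `z` at which g stops being positive, f has not dropped below its initial
    -- value, so the speed bound still applies at `z` and contradicts g z = 0.
    obtain ⟨z, hz, hz1, hz2⟩ : ∃ z ∈ Icc x r, 0 ≤ -g z ∧ ∀ s ∈ Ico x z, -g s < 0 :=
      exists_first_nonneg hg.neg hr.1 (by linarith : 0 ≤ -g r)
    have hz' : z ∈ Icc x y := ⟨hz.1, hz.2.trans hr.2⟩
    have hxz : x < z := lt_of_le_of_ne hz.1 fun h => by rw [← h] at hz1; linarith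
    have hz3 : ∀ r ∈ Ico x z, 0 < g r := fun r hr => neg_lt_zero.1 (hz2 r hr)
    have hle : 0 ≤ g z := ge_of_tendsto (hg.continuousWithinAt (s := Iio z) (x := z)).tendsto (by
      filter_upwards [Ioo_mem_nhdsLT hxz] with r hr
      exact (hz3 r ⟨hr.1.le, hr.2⟩).le)
    have h0 : g z = 0 := le_antisymm (by linarith) hle
    have := hspeed z hz' (hmono z hz' hz3 ⟨le_rfl, hz.1⟩ ⟨hz.1, le_rfl⟩ hz.1)
    rw [h0, abs_zero] at this
    linarith
  have hm := hmono y ⟨hxy, le_rfl⟩ fun r hr => hpos r ⟨hr.1, hr.2.le⟩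
  refine (convex_Icc x y).mul_sub_le_image_sub_of_le_deriv
    (HasDerivAt.continuousOn hf) ?_ ?_ x ⟨le_rfl, hxy⟩ y ⟨hxy, le_rfl⟩ hxy
  · rw [interior_Icc]
    exact fun r hr => (hf r (Ioo_subset_Icc_self hr)).differentiableAt.differentiableWithinAt
  · rw [interior_Icc]
    intro r hr
    have hr' := Ioo_subset_Icc_self hr
    rw [(hf r hr').deriv, ← abs_of_pos (hpos r hr')]
    exact hspeed r hr' (hm ⟨le_rfl, hxy⟩ hr' hr'.1)

section Shot

variable {lam ε α e σ : ℝ} {R S : ℝ → ℝ}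

/-- Where R > 0 the cubic is nonpositive. On the first half of the window cos r ≥ l/4, so ε²R'' ≤
−l/4 for a time l/2, which contradicts boundedness. -/
theorem IsTrapped.not_pos_on_window (ht : IsTrapped lam ε e R S σ) (h : IsShot lam ε α R S)
    (hlam : lambda0 < lam) (hε : 0 < ε) {a l : ℝ} (hl : 0 < l) (ha : σ ≤ a)
    (hal : a + l ≤ Real.pi / 2) (hεl : 256 * √lam * ε ^ 2 < l ^ 3) :
    ¬ ∀ x ∈ Ioo a (a + l), 0 < R x := by
  intro hR
  have hpos : 0 < lam := lambda0_pos.trans hlam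
  have hk2 := Real.sq_sqrt hpos.le
  have hσ := ht.pos
  have key := second_deriv_mul_sq_le (f := fun r => -R r) (g := fun r => -S r)
    (A := l / 4 / ε ^ 2) (k := √lam) (a := a) (b := a + l / 2) (by linarith)
    (fun x hx => (h.hasDerivAt_R x ⟨by linarith [hx.1], by linarith [hx.2]⟩).neg)
    (fun x _ => (h.hasDerivAt_S x).neg) ?_
    (fun x hx => by
      rw [abs_neg]
      exact ht.abs_le hlam ⟨by linarith [hx.1], by linarith [hx.2]⟩)
  · have e : l / 4 / ε ^ 2 * (a + l / 2 - a) ^ 2 = l ^ 3 / 16 / ε ^ 2 := by ring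
    rw [e, div_le_iff₀ (by positivity)] at key
    linarith
  · intro x hx
    have hx' : x ∈ Icc σ (Real.pi / 2) := ⟨by linarith [hx.1], by linarith [hx.2]⟩
    rw [← neg_div]
    apply div_le_div_of_nonneg_right _ (sq_nonneg ε)
    rw [clamp_of_abs_le (ht.abs_le hlam hx')]
    have h1 := hR x ⟨hx.1, by linarith [hx.2]⟩
    have h2 := ht.upper x hx'
    have h3 : cubic lam (R x) ≤ 0 := by
      have : cubic lam (R x) = -(R x * (lam - R x ^ 2)) := by unfold cubic; ring
      rw [this, neg_nonpos]
      exact mul_nonneg h1.le (by nlinarith)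
    have h4 : l / 4 ≤ Real.cos x := by
      rw [← Real.sin_pi_div_two_sub]
      have h5 := Real.mul_le_sin (x := Real.pi / 2 - x) (by linarith [hx.2]) (by linarith [hx.1])
      have h6 : 2 / Real.pi * (l / 2) ≤ 2 / Real.pi * (Real.pi / 2 - x) :=
        mul_le_mul_of_nonneg_left (by linarith [hx.2]) (by positivity)
      have h7 : l / 4 ≤ 2 / Real.pi * (l / 2) := by
        rw [div_mul_div_comm, mul_comm Real.pi, mul_div_mul_left _ _ two_ne_zero]
        exact div_le_div_of_nonneg_left hl.le Real.pi_pos Real.pi_lt_four.le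
      linarith
    linarith

/-- Above −√(λ/2) the speed is at least λ/(4ε). Following R forward or backward in time, according
to the sign of S, it rises by √λ within l/4 and stops being negative. The margin l/12 at each end
keeps the argument inside the open window. -/
theorem IsTrapped.le_near_bottom (ht : IsTrapped lam ε e R S σ) (h : IsShot lam ε α R S)
    (hlam : lambda0 < lam) (hε : 0 < ε) (he : e ≤ lam ^ 2 / 32) {a l : ℝ} (hl : 0 < l)
    (ha : σ ≤ a) (hal : a + l ≤ Real.pi / 2) (hεl : 16 * √lam * ε ≤ lam * l)
    (hR : ∀ x ∈ Ioo a (a + l), R x < 0) :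
    ∀ x ∈ Icc (a + l / 3) (a + 2 * l / 3), R x ≤ -√(lam / 2) := by
  have hpos : 0 < lam := lambda0_pos.trans hlam
  have hk2 : √(lam / 2) ^ 2 = lam / 2 := Real.sq_sqrt (by positivity)
  have hk3 := Real.sqrt_nonneg (lam / 2)
  have hσ := ht.pos
  intro x hx
  by_contra! hc
  have hwin : ∀ r ∈ Icc (a + l / 12) (a + 11 * l / 12), r ∈ Ioo a (a + l) := fun r hr =>
    ⟨by linarith [hr.1], by linarith [hr.2]⟩
  have hin : ∀ r ∈ Ioo a (a + l), r ∈ Icc σ (Real.pi / 2) := fun r hr =>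
    ⟨by linarith [hr.1], by linarith [hr.2]⟩
  have hd : ∀ r ∈ Ioo a (a + l), HasDerivAt R (S r) r := fun r hr =>
    h.hasDerivAt_R r ⟨by linarith [hr.1], by linarith [hr.2]⟩
  have hlow : ∀ r ∈ Ioo a (a + l), -√lam ≤ R r := fun r hr =>
    (_root_.abs_le.1 (ht.abs_le hlam (hin r hr))).1
  have hspeed : ∀ r ∈ Ioo a (a + l), R x ≤ R r → lam / (4 * ε) ≤ |S r| := by
    intro r hr hxr
    apply ht.le_abs_S_of_abs_R_le hpos hε he (hin r hr)
    nlinarith [hR r hr]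
  have hcpos : 0 < lam / (4 * ε) := by positivity
  have hbig : √lam ≤ lam / (4 * ε) * (l / 4) := by
    have : lam / (4 * ε) * (l / 4) = lam * l / (16 * ε) := by field_simp; norm_num
    rw [this, le_div_iff₀ (by positivity)]
    linarith
  have hx' : x ∈ Ioo a (a + l) := ⟨by linarith [hx.1], by linarith [hx.2]⟩
  have hSx : S x ≠ 0 := by
    intro h0
    have := hspeed x hx' le_rfl
    rw [h0, abs_zero] at this
    linarith
  rcases lt_or_gt_of_ne hSx with hneg | hpos'
  · have hsub : ∀ r ∈ Icc (-x) (-(a + l / 12)), -r ∈ Ioo a (a + l) := fun r hr =>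
      ⟨by linarith [hr.2], by linarith [hr.1, hx.2]⟩
    have key := mul_sub_le_of_speed (f := fun r => R (-r)) (g := fun r => -S (-r)) hcpos
      (x := -x) (y := -(a + l / 12)) (by linarith [hx.1])
      (fun r hr => by
        simpa [Function.comp_def] using (hd (-r) (hsub r hr)).scomp r (hasDerivAt_neg r))
      (h.continuous_S.comp continuous_neg).neg
      (fun r hr hxr => by
        rw [abs_neg]
        rw [neg_neg] at hxr
        exact hspeed (-r) (hsub r hr) hxr)
      (by rw [neg_neg]; linarith)
    simp only [neg_neg] at key
    have h1 : lam / (4 * ε) * (l / 4) ≤ lam / (4 * ε) * (-(a + l / 12) - -x) :=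
      mul_le_mul_of_nonneg_left (by linarith [hx.1]) hcpos.le
    have h2 : a + l / 12 ∈ Ioo a (a + l) := ⟨by linarith, by linarith⟩
    linarith [hR _ h2, hlow x hx']
  · have hsub : ∀ r ∈ Icc x (a + 11 * l / 12), r ∈ Ioo a (a + l) := fun r hr =>
      ⟨by linarith [hr.1, hx.1], by linarith [hr.2]⟩
    have key := mul_sub_le_of_speed (f := R) (g := S) hcpos
      (x := x) (y := a + 11 * l / 12) (by linarith [hx.2])
      (fun r hr => hd r (hsub r hr)) h.continuous_S
      (fun r hr hxr => hspeed r (hsub r hr) hxr) hpos'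
    have h1 : lam / (4 * ε) * (l / 4) ≤ lam / (4 * ε) * (a + 11 * l / 12 - x) :=
      mul_le_mul_of_nonneg_left (by linarith [hx.2]) hcpos.le
    have h2 : a + 11 * l / 12 ∈ Ioo a (a + l) := ⟨by linarith, by linarith⟩
    linarith [hR _ h2, hlow x hx']

/-- Near the lower branch the speed of a trapped shot is controlled by its height. -/
theorem IsTrapped.abs_S_le (ht : IsTrapped lam ε e R S σ) (hlam : lambda0 < lam)
    {r : ℝ} (hr : r ∈ Icc σ (Real.pi / 2)) (hR : R r ≤ 0) :
    ε * |S r| ≤ √(2 * lam) * (R r - lowerBranch lam r) := by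
  have hpos : 0 < lam := lambda0_pos.trans hlam
  have hk := Real.sqrt_pos.2 hpos
  have hk2 := Real.sq_sqrt hpos.le
  have h1 := ht.gap_neg r hr
  have h2 := ht.lower r hr
  have h3 := neg_sqrt_le_lowerBranch hlam (r := r)
    (Real.cos_nonneg_of_mem_Icc ⟨by linarith [Real.pi_pos, hr.1, ht.pos], hr.2⟩)
  unfold gap at h1
  rw [potential_sub_lowerBranch] at h1
  set w := R r - lowerBranch lam r with hw
  have hR2 : R r ^ 2 ≤ lam := by nlinarith
  have hL2 : lowerBranch lam r ^ 2 ≤ lam := by nlinarith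
  have hRL : R r * lowerBranch lam r ≤ lam := by nlinarith [sq_nonneg (R r - lowerBranch lam r)]
  have h5 : w ^ 2 * (R r ^ 2 + 2 * R r * lowerBranch lam r + 3 * lowerBranch lam r ^ 2 - 2 * lam) ≤
      w ^ 2 * (4 * lam) := mul_le_mul_of_nonneg_left (by linarith) (sq_nonneg w)
  have h6 : (ε * |S r|) ^ 2 ≤ (√(2 * lam) * w) ^ 2 := by
    rw [mul_pow, mul_pow, sq_abs, Real.sq_sqrt (by positivity)]
    nlinarith
  exact le_of_sq_le_sq h6 (mul_nonneg (Real.sqrt_nonneg _) (by linarith))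

theorem IsTrapped.lower_bound_height (ht : IsTrapped lam ε e R S σ) (h : IsShot lam ε α R S)
    (hlam : lambda0 < lam) (hε : 0 < ε) (hσ : Real.pi / 6 ≤ σ) {a x : ℝ} (ha : σ ≤ a)
    (hx : x ≤ Real.pi / 2) (hax : ε ≤ √(2 * lam) * (x - a)) (hR : ∀ r ∈ Icc a x, R r ≤ 0) :
    ε / (8 * lam * √(2 * lam)) ≤ R x - lowerBranch lam x := by
  have hpos : 0 < lam := lambda0_pos.trans hlam
  have hK : 0 < √(2 * lam) := Real.sqrt_pos.2 (by positivity)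
  set K := √(2 * lam) with hKdef
  have hax' : a ≤ x := by
    by_contra! hc
    have : K * (x - a) < 0 := mul_neg_of_pos_of_neg hK (by linarith)
    linarith
  -- The height w above the branch obeys w' ≥ −(K/ε)w + 1/(4λ): the first term is the speed bound,
  -- the second the drift of the branch, using sin r ≥ 1/2. Here μ is the equilibrium of the
  -- comparison equation; starting from w > 0, after time ε/K the height is at least μ/2.
  set μ : ℝ := ε / (4 * lam * K) with hμ
  have hμpos : 0 < μ := by positivity
  set w : ℝ → ℝ := fun r => R r - lowerBranch lam r with hw
  have hin : ∀ r ∈ Icc a x, r ∈ Icc σ (Real.pi / 2) := fun r hr =>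
    ⟨ha.trans hr.1, hr.2.trans hx⟩
  have hd : ∀ r ∈ Icc a x, HasDerivAt (fun r => (w r - μ) * Real.exp (K / ε * r))
      (((S r + Real.sin r / (3 * lowerBranch lam r ^ 2 - lam)) + K / ε * (w r - μ)) *
        Real.exp (K / ε * r)) r := by
    intro r hr
    have h1 := h.hasDerivAt_sub_lowerBranch hlam (r := r)
      ⟨ht.pos.le.trans (hin r hr).1, (hin r hr).2⟩
    have h2 := (((hasDerivAt_id r).const_mul (K / ε)).exp)
    refine ((h1.sub_const μ).mul h2).congr_deriv ?_
    simp only [hw, id, mul_one]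
    ring
  have hmono : MonotoneOn (fun r => (w r - μ) * Real.exp (K / ε * r)) (Icc a x) := by
    refine monotoneOn_of_deriv_nonneg (convex_Icc a x) (HasDerivAt.continuousOn hd) ?_ ?_
    · rw [interior_Icc]
      exact fun r hr => (hd r (Ioo_subset_Icc_self hr)).differentiableAt.differentiableWithinAt
    · rw [interior_Icc]
      intro r hr
      have hr' := Ioo_subset_Icc_self hr
      rw [(hd r hr').deriv]
      apply mul_nonneg _ (Real.exp_pos _).le
      have h1 := ht.abs_S_le hlam (hin r hr') (hR r hr')
      have h2 : -(K / ε * w r) ≤ S r := by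
        have h3 : |S r| ≤ K / ε * w r := by
          rw [div_mul_eq_mul_div, le_div_iff₀ hε]
          linarith
        linarith [neg_abs_le (S r)]
      have h4 : 1 / (4 * lam) ≤ Real.sin r / (3 * lowerBranch lam r ^ 2 - lam) := by
        have hs : 1 / 2 ≤ Real.sin r := by
          rw [← Real.sin_pi_div_six]
          exact Real.sin_le_sin_of_le_of_le_pi_div_two (by linarith [Real.pi_pos])
            (hin r hr').2 (hσ.trans (hin r hr').1)
        have hq := exists_pos_slope_lowerBranch hlam r
        have hl := neg_sqrt_le_lowerBranch hlam (r := r) (Real.cos_nonneg_of_mem_Icc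
          ⟨by linarith [Real.pi_pos, (hin r hr').1, ht.pos], (hin r hr').2⟩)
        have hk2 := Real.sq_sqrt hpos.le
        have hl0 : lowerBranch lam r < 0 :=
          (lowerBranch_lt_turningPoint hlam r).trans (turningPoint_neg hpos)
        have hq2 : 3 * lowerBranch lam r ^ 2 - lam ≤ 2 * lam := by nlinarith
        rw [div_le_div_iff₀ (by positivity) hq]
        nlinarith
      have h5 : K / ε * μ = 1 / (4 * lam) := by rw [hμ]; field_simp
      rw [mul_sub, h5]
      linarith
  have hfin := hmono ⟨le_rfl, hax'⟩ ⟨hax', le_rfl⟩ hax'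
  simp only at hfin
  have hwa : 0 < w a := sub_pos.2 (ht.lower a (hin a ⟨le_rfl, hax'⟩))
  have hexp : Real.exp (K / ε * x) = Real.exp (K / ε * a) * Real.exp (K / ε * (x - a)) := by
    rw [← Real.exp_add]; ring_nf
  have hE := Real.exp_pos (K / ε * a)
  rw [hexp] at hfin
  have h1 : -μ ≤ (w x - μ) * Real.exp (K / ε * (x - a)) := by
    have : -μ * Real.exp (K / ε * a) ≤
        ((w x - μ) * Real.exp (K / ε * (x - a))) * Real.exp (K / ε * a) := by
      nlinarith [mul_pos hwa hE]
    exact le_of_mul_le_mul_right this hE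
  have h2 : 2 ≤ Real.exp (K / ε * (x - a)) := by
    have h3 : 1 ≤ K / ε * (x - a) := by
      rw [div_mul_eq_mul_div, le_div_iff₀ hε]; linarith
    linarith [Real.add_one_le_exp (K / ε * (x - a))]
  have h3 : ε / (8 * lam * K) = μ / 2 := by rw [hμ, div_div]; ring_nf
  rw [h3]
  change μ / 2 ≤ w x
  by_contra! hc
  nlinarith

/-- In the middle third R is near the bottom, and the drift keeps it ε/(8λK) above the branch, with
K = √(2λ). Hence R'' ≥ 1/(16Kε) for a time l/6, giving l² ≤ 9216 K√λ ε ≤ 18432 λε, against the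
hypothesis. -/
theorem IsTrapped.not_neg_on_window (ht : IsTrapped lam ε e R S σ) (h : IsShot lam ε α R S)
    (hlam : lambda0 < lam) (hε : 0 < ε) (he : e ≤ lam ^ 2 / 32) (hσ : Real.pi / 6 ≤ σ) {a l : ℝ}
    (hl : 0 < l) (ha : σ ≤ a) (hal : a + l ≤ Real.pi / 2) (hε1 : 16 * √lam * ε ≤ lam * l)
    (hε2 : 20000 * lam * ε < l ^ 2) :
    ¬ ∀ x ∈ Ioo a (a + l), R x < 0 := by
  intro hR
  have hpos : 0 < lam := lambda0_pos.trans hlam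
  have hk := Real.sqrt_pos.2 hpos
  have hk2 := Real.sq_sqrt hpos.le
  have hK : 0 < √(2 * lam) := Real.sqrt_pos.2 (by positivity)
  have hK2 : √(2 * lam) ^ 2 = 2 * lam := Real.sq_sqrt (by positivity)
  have hkK : √lam ≤ √(2 * lam) := Real.sqrt_le_sqrt (by linarith)
  have hKk : √(2 * lam) * √lam ≤ 2 * lam := by nlinarith
  have hσ0 := ht.pos
  have hbot := ht.le_near_bottom h hlam hε he hl ha hal hε1 hR
  have hh2 : √(lam / 2) ^ 2 = lam / 2 := Real.sq_sqrt (by positivity)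
  have hh0 := Real.sqrt_nonneg (lam / 2)
  set K := √(2 * lam) with hKdef
  -- The relaxation time ε/K fits between a + l/3 and a + l/2.
  have hεK : ε ≤ K * (l / 6) := by
    have : 16 * ε ≤ √lam * l := by
      have h1 : √lam * (16 * ε) ≤ √lam * (√lam * l) := by nlinarith
      exact le_of_mul_le_mul_left h1 hk
    nlinarith
  have key := second_deriv_mul_sq_le (f := R) (g := S) (A := 1 / (16 * K * ε)) (k := √lam)
    (a := a + l / 2) (b := a + 2 * l / 3) (by linarith)
    (fun x hx => h.hasDerivAt_R x ⟨by linarith [hx.1], by linarith [hx.2]⟩)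
    (fun x _ => h.hasDerivAt_S x) ?_
    (fun x hx => ht.abs_le hlam ⟨by linarith [hx.1], by linarith [hx.2]⟩)
  · have e : 1 / (16 * K * ε) * (a + 2 * l / 3 - (a + l / 2)) ^ 2 = l ^ 2 / 36 / (16 * K * ε) := by
      ring
    rw [e, div_le_iff₀ (by positivity)] at key
    nlinarith
  · intro x hx
    have hx' : x ∈ Icc σ (Real.pi / 2) := ⟨by linarith [hx.1], by linarith [hx.2]⟩
    have hb := hbot x ⟨by linarith [hx.1], by linarith [hx.2]⟩
    have hw := ht.lower_bound_height h hlam hε hσ (a := a + l / 3) (x := x) (by linarith)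
      hx'.2 (hεK.trans (mul_le_mul_of_nonneg_left (by linarith [hx.1]) hK.le))
      (fun r hr => (hR r ⟨by linarith [hr.1], by linarith [hr.2, hx.2]⟩).le)
    have hlow := ht.lower x hx'
    rw [clamp_of_abs_le (ht.abs_le hlam hx'), ← cubic_lowerBranch lam x, cubic_sub,
      le_div_iff₀ (by positivity)]
    have h1 : lam / 2 ≤ R x ^ 2 + R x * lowerBranch lam x + lowerBranch lam x ^ 2 - lam := by
      have e1 : lam / 2 ≤ R x ^ 2 := by nlinarith
      have e2 : lam / 2 ≤ R x * lowerBranch lam x := by nlinarith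
      have e3 : lam / 2 ≤ lowerBranch lam x ^ 2 := by nlinarith
      linarith
    have h2 : ε / (8 * lam * K) * (lam / 2) ≤ (R x - lowerBranch lam x) *
        (R x ^ 2 + R x * lowerBranch lam x + lowerBranch lam x ^ 2 - lam) :=
      mul_le_mul hw h1 (by positivity) (by linarith)
    have h3 : ε / (8 * lam * K) * (lam / 2) = 1 / (16 * K * ε) * ε ^ 2 := by
      field_simp; norm_num
    linarith

/-- A trapped shot vanishes somewhere in each time window of fixed length. -/
theorem IsTrapped.exists_zero (ht : IsTrapped lam ε e R S σ) (h : IsShot lam ε α R S)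
    (hlam : lambda0 < lam) (hε : 0 < ε) (he : e ≤ lam ^ 2 / 32) (hσ : Real.pi / 6 ≤ σ) {a l : ℝ}
    (hl : 0 < l) (ha : σ ≤ a) (hal : a + l ≤ Real.pi / 2) (hε1 : 16 * √lam * ε ≤ lam * l)
    (hε2 : 20000 * lam * ε < l ^ 2) (hε3 : 256 * √lam * ε ^ 2 < l ^ 3) :
    ∃ x ∈ Ioo a (a + l), R x = 0 := by
  by_contra! hne
  have hm : a + l / 2 ∈ Ioo a (a + l) := ⟨by linarith, by linarith⟩
  rcases lt_or_gt_of_ne (hne _ hm) with h1 | h1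
  · refine ht.not_neg_on_window h hlam hε he hσ hl ha hal hε1 hε2 fun x hx => ?_
    have := pos_of_no_zero (f := fun x => -R x) isPreconnected_Ioo
      h.continuous_R.neg.continuousOn (fun x hx => neg_ne_zero.2 (hne x hx)) hm (by linarith) x hx
    linarith
  · exact ht.not_pos_on_window h hlam hε hl ha hal hε3
      (pos_of_no_zero isPreconnected_Ioo h.continuous_R.continuousOn hne hm h1)

end Shot

/-! ### Persistence of simple zeros -/

theorem eventually_mul_neg_of_simple_zero {f : ℝ → ℝ} {d y : ℝ} (h : HasDerivAt f d y) (hd : d ≠ 0)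
    (hy : f y = 0) : ∀ᶠ ρ in 𝓝[>] (0 : ℝ), f (y - ρ) * f (y + ρ) < 0 := by
  have key : ∀ {g : ℝ → ℝ} {d : ℝ}, HasDerivAt g d y → 0 < d → g y = 0 →
      ∀ᶠ ρ in 𝓝[>] (0 : ℝ), g (y - ρ) * g (y + ρ) < 0 := by
    intro g d h hd hy
    have h1 := eventually_gt_of_hasDerivAt_pos h hd
    have h2 := eventually_lt_of_hasDerivAt_pos h hd
    have t1 : Tendsto (fun ρ : ℝ => y + ρ) (𝓝[>] 0) (𝓝[>] y) := by
      apply tendsto_nhdsWithin_of_tendsto_nhds_of_eventually_within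
      · have : Continuous fun ρ : ℝ => y + ρ := by fun_prop
        simpa using (this.tendsto 0).mono_left nhdsWithin_le_nhds
      · filter_upwards [self_mem_nhdsWithin] with ρ (hρ : 0 < ρ)
        exact lt_add_of_pos_right y hρ
    have t2 : Tendsto (fun ρ : ℝ => y - ρ) (𝓝[>] 0) (𝓝[<] y) := by
      apply tendsto_nhdsWithin_of_tendsto_nhds_of_eventually_within
      · have : Continuous fun ρ : ℝ => y - ρ := by fun_prop
        simpa using (this.tendsto 0).mono_left nhdsWithin_le_nhds
      · filter_upwards [self_mem_nhdsWithin] with ρ (hρ : 0 < ρ)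
        exact sub_lt_self y hρ
    filter_upwards [t1.eventually h1, t2.eventually h2] with ρ e1 e2
    rw [hy] at e1 e2
    exact mul_neg_of_neg_of_pos e2 e1
  rcases lt_or_gt_of_ne hd with hd | hd
  · simpa using key h.neg (neg_pos.2 hd) (by simp [hy])
  · exact key h hd hy

theorem exists_zero_of_mul_neg {f : ℝ → ℝ} (hf : Continuous f) {a b : ℝ} (hab : a ≤ b)
    (h : f a * f b < 0) : ∃ x ∈ Ioo a b, f x = 0 := by
  rcases mul_neg_iff.1 h with ⟨h1, h2⟩ | ⟨h1, h2⟩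
  · exact intermediate_value_Ioo' hab hf.continuousOn ⟨h2, h1⟩
  · exact intermediate_value_Ioo hab hf.continuousOn ⟨h1, h2⟩

/-- Simple zeros persist under perturbation of a parameter. -/
theorem eventually_exists_zeros {F : ℝ → ℝ → ℝ} (hF : Continuous fun p : ℝ × ℝ => F p.1 p.2)
    {α a b : ℝ} {n : ℕ} {y d : Fin n → ℝ} (hy : StrictMono y) (hmem : ∀ i, y i ∈ Ioo a b)
    (hzero : ∀ i, F α (y i) = 0) (hd : ∀ i, HasDerivAt (F α) (d i) (y i)) (hd0 : ∀ i, d i ≠ 0) :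
    ∀ᶠ β in 𝓝 α, ∃ y' : Fin n → ℝ, StrictMono y' ∧ ∀ i, y' i ∈ Ioo a b ∧ F β (y' i) = 0 := by
  have lim : ∀ {g : ℝ → ℝ}, Continuous g → 0 < g 0 → ∀ᶠ ρ in 𝓝[>] (0 : ℝ), 0 < g ρ :=
    fun hg h0 => ((hg.tendsto 0).mono_left nhdsWithin_le_nhds).eventually (lt_mem_nhds h0)
  -- A radius ρ is chosen so that the intervals around the zeros are disjoint, lie in (a, b) and
  -- carry a sign change; the finitely many endpoint signs persist for nearby parameters.
  have h1 : ∀ᶠ ρ in 𝓝[>] (0 : ℝ), ∀ i, F α (y i - ρ) * F α (y i + ρ) < 0 :=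
    eventually_all.2 fun i => eventually_mul_neg_of_simple_zero (hd i) (hd0 i) (hzero i)
  have h2 : ∀ᶠ ρ in 𝓝[>] (0 : ℝ), ∀ i, 0 < y i - ρ - a :=
    eventually_all.2 fun i => lim (by fun_prop) (by linarith [(hmem i).1])
  have h3 : ∀ᶠ ρ in 𝓝[>] (0 : ℝ), ∀ i, 0 < b - (y i + ρ) :=
    eventually_all.2 fun i => lim (by fun_prop) (by linarith [(hmem i).2])
  have h4 : ∀ᶠ ρ in 𝓝[>] (0 : ℝ), ∀ i j, i < j → 0 < y j - ρ - (y i + ρ) := by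
    refine eventually_all.2 fun i => eventually_all.2 fun j => ?_
    by_cases hij : i < j
    · exact (lim (g := fun ρ => y j - ρ - (y i + ρ)) (by fun_prop) (by linarith [hy hij])).mono
        fun _ h _ => h
    · exact Eventually.of_forall fun _ h => absurd h hij
  obtain ⟨ρ, ⟨⟨⟨⟨h1, h2⟩, h3⟩, h4⟩, hρ⟩⟩ :=
    ((((h1.and h2).and h3).and h4).and self_mem_nhdsWithin).exists
  have hρ : 0 < ρ := hρ
  have hev : ∀ᶠ β in 𝓝 α, ∀ i, F β (y i - ρ) * F β (y i + ρ) < 0 := by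
    refine eventually_all.2 fun i => ?_
    have hc : Continuous fun β => F β (y i - ρ) * F β (y i + ρ) :=
      (hF.comp (by fun_prop : Continuous fun β : ℝ => (β, y i - ρ))).mul
        (hF.comp (by fun_prop : Continuous fun β : ℝ => (β, y i + ρ)))
    exact (hc.tendsto α).eventually (gt_mem_nhds (h1 i))
  filter_upwards [hev] with β hβ
  have hc : Continuous (F β) := hF.comp (by fun_prop : Continuous fun r : ℝ => (β, r))
  choose y' hy' hy0 using fun i => exists_zero_of_mul_neg hc
    (by linarith : y i - ρ ≤ y i + ρ) (hβ i)
  refine ⟨y', fun i j hij => ?_, fun i => ⟨⟨?_, ?_⟩, hy0 i⟩⟩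
  · linarith [(hy' i).2, (hy' j).1, h4 i j hij]
  · linarith [(hy' i).1, h2 i]
  · linarith [(hy' i).2, h3 i]

/-! ### First critical points and separation of zeros -/

section Shot

variable {lam ε α e σ : ℝ} {R S : ℝ → ℝ}

theorem cubic_clamp_start (hlam : lambda0 < lam) (h : IsShot lam ε α R S) (h1 : -√lam ≤ α)
    (h2 : α ≤ lowerBranch lam 0) : cubic lam (clamp (√lam) (R 0)) = cubic lam α := by
  have hpos : 0 < lam := lambda0_pos.trans hlam
  have := lowerBranch_lt_turningPoint hlam 0
  have := turningPoint_neg hpos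
  have := Real.sqrt_nonneg lam
  rw [h.R_zero, clamp_of_abs_le (abs_le.2 ⟨h1, by linarith⟩)]

/-- The initial acceleration is 0, so by continuity R leaves the branch value by at most a small
multiple of r², while cos r falls by about r²/2: the acceleration becomes positive at once. This
excludes α = L(0) in the first minimisation. -/
theorem IsShot.exists_S_pos_of_start_on_branch (hlam : lambda0 < lam) (hε : 0 < ε)
    (h : IsShot lam ε (lowerBranch lam 0) R S) {ρ : ℝ} (hρ : 0 < ρ) : ∃ r ∈ Ioo 0 ρ, 0 < S r := by
  have hpos : 0 < lam := lambda0_pos.trans hlam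
  set b := lowerBranch lam 0 with hb
  have hbk : -√lam ≤ b := neg_sqrt_le_lowerBranch hlam (by simp)
  have hb1 : cubic lam b = 1 := by rw [hb, cubic_lowerBranch, Real.cos_zero]
  have hstart := cubic_clamp_start hlam h hbk le_rfl
  set acc : ℝ → ℝ := fun r => (cubic lam (clamp (√lam) (R r)) - Real.cos r) / ε ^ 2 with hacc
  have hacc0 : acc 0 = 0 := by simp [hacc, hstart, hb1]
  have hcont : Continuous acc := by
    have := h.continuous_R
    simp only [hacc, cubic, clamp]
    fun_prop
  -- With Lipschitz constant 4λ for the cubic, |R − b| ≤ ηr² changes it by at most r²/8.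
  set η : ℝ := 1 / (32 * lam) with hη
  have hηpos : 0 < η := by positivity
  obtain ⟨ρ₁, hρ₁, hsmall⟩ : ∃ ρ₁ > 0, ∀ r, |r| < ρ₁ → |acc r| < η := by
    obtain ⟨ρ₁, h1, h2⟩ := Metric.continuous_iff.1 hcont 0 η hηpos
    refine ⟨ρ₁, h1, fun r hr => ?_⟩
    have := h2 r (by simpa [Real.dist_eq] using hr)
    rwa [hacc0, Real.dist_eq, sub_zero] at this
  set c : ℝ := min (ρ / 2) (min (ρ₁ / 2) 1) with hc
  have hc0 : 0 < c := by positivity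
  have hcρ : c ≤ ρ / 2 := min_le_left _ _
  have hcρ₁ : c ≤ ρ₁ / 2 := (min_le_right _ _).trans (min_le_left _ _)
  have hc1 : c ≤ 1 := (min_le_right _ _).trans (min_le_right _ _)
  have hpi := Real.pi_gt_three
  have hS : ∀ r ∈ Icc 0 c, |S r| ≤ η * r := by
    intro r hr
    have := (convex_Icc 0 r).norm_image_sub_le_of_norm_hasDerivWithin_le (f := S) (C := η)
      (fun x _ => (h.hasDerivAt_S x).hasDerivWithinAt) (fun x hx => (hsmall x (by
        rw [abs_of_nonneg hx.1]; linarith [hx.2, hr.2])).le) ⟨le_rfl, hr.1⟩ ⟨hr.1, le_rfl⟩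
    simpa [h.S_zero, abs_of_nonneg hr.1] using this
  have hR : ∀ r ∈ Icc 0 c, |R r - b| ≤ η * r ^ 2 := by
    intro r hr
    have := (convex_Icc 0 r).norm_image_sub_le_of_norm_hasDerivWithin_le (f := R) (C := η * r)
      (fun x hx => (h.hasDerivAt_R x ⟨hx.1, by linarith [hx.2, hr.2]⟩).hasDerivWithinAt)
      (fun x hx => (hS x ⟨hx.1, hx.2.trans hr.2⟩).trans
        (mul_le_mul_of_nonneg_left hx.2 hηpos.le)) ⟨le_rfl, hr.1⟩ ⟨hr.1, le_rfl⟩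
    rw [h.R_zero, sub_zero, Real.norm_eq_abs, Real.norm_eq_abs, abs_of_nonneg hr.1] at this
    linarith
  have haccpos : ∀ r ∈ Ioo 0 c, 0 < acc r := by
    intro r hr
    apply div_pos _ (by positivity)
    have hk := Real.sqrt_nonneg lam
    have h1 := abs_cubic_sub_le hpos.le (abs_clamp_le hk (R r)) (abs_clamp_le hk (R 0))
    rw [hstart, hb1] at h1
    have h2 : |clamp (√lam) (R r) - clamp (√lam) (R 0)| ≤ η * r ^ 2 :=
      (abs_clamp_sub_le (√lam) (R r) (R 0)).trans
        (by rw [h.R_zero]; exact hR r ⟨hr.1.le, hr.2.le⟩)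
    have h3 : 4 * lam * |clamp (√lam) (R r) - clamp (√lam) (R 0)| ≤ r ^ 2 / 8 := by
      refine (mul_le_mul_of_nonneg_left h2 (by positivity)).trans_eq ?_
      rw [hη]; field_simp; ring
    have h4 := (abs_le.1 (h1.trans h3)).1
    have h5 := (abs_le.1 (Real.cos_bound (x := r) (by
      rw [abs_of_pos hr.1]; linarith [hr.2]))).2
    rw [abs_of_pos hr.1] at h5
    have h6 : r ^ 4 ≤ r ^ 2 := pow_le_pow_of_le_one hr.1.le (by linarith [hr.2]) (by norm_num)
    have h7 : 0 < r ^ 2 := pow_pos hr.1 2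
    linarith
  obtain ⟨ξ, hξ, hξ'⟩ := exists_hasDerivAt_eq_slope S acc hc0 h.continuous_S.continuousOn
    (fun x _ => h.hasDerivAt_S x)
  refine ⟨c, ⟨hc0, by linarith⟩, ?_⟩
  have := haccpos ξ hξ
  rw [hξ', h.S_zero, sub_zero, sub_zero] at this
  exact (div_pos_iff_of_pos_right hc0).1 this

/-- A shot that starts below the branch has a first critical point, if it has any. -/
theorem IsShot.exists_first_critical (h : IsShot lam ε α R S) (hlam : lambda0 < lam) (hε : 0 < ε)
    (h1 : -√lam ≤ α) (h2 : α < lowerBranch lam 0) {r : ℝ} (hr : 0 < r) (hSr : 0 ≤ S r) :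
    ∃ c ∈ Ioc 0 r, (∀ x ∈ Ioo 0 c, S x < 0) ∧ S c = 0 := by
  have hpos : 0 < lam := lambda0_pos.trans hlam
  have hneg : 0 < -((cubic lam (clamp (√lam) (R 0)) - Real.cos 0) / ε ^ 2) := by
    rw [cubic_clamp_start hlam h h1 h2.le, ← neg_div]
    have := (lt_lowerBranch_iff hlam (r := 0)
      (h2.trans (lowerBranch_lt_turningPoint hlam 0)).le).1 h2
    exact div_pos (by linarith) (by positivity)
  have hev := eventually_gt_of_hasDerivAt_pos (h.hasDerivAt_S 0).neg hneg
  simp only [Pi.neg_apply, h.S_zero, neg_zero] at hev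
  obtain ⟨u, hu, hsub⟩ := mem_nhdsGT_iff_exists_Ioo_subset.1 hev
  have hu : 0 < u := hu
  set ρ := min (u / 2) r with hρ
  have hρ0 : 0 < ρ := by positivity
  have hρu : ρ < u := (min_le_left _ _).trans_lt (by linarith)
  obtain ⟨c, hc, hc1, hc2⟩ := exists_first_nonneg h.continuous_S (min_le_right (u / 2) r) hSr
  have hlt : ∀ x ∈ Ioo 0 c, S x < 0 := by
    intro x hx
    rcases lt_or_ge x ρ with hx' | hx'
    · have : 0 < -S x := hsub ⟨hx.1, hx'.trans hρu⟩
      linarith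
    · exact hc2 x ⟨hx', hx.2⟩
  have hc0 : 0 < c := hρ0.trans_le hc.1
  refine ⟨c, ⟨hc0, hc.2⟩, hlt, le_antisymm ?_ hc1⟩
  refine le_of_tendsto (h.continuous_S.continuousWithinAt (s := Iio c) (x := c)).tendsto ?_
  filter_upwards [Ioo_mem_nhdsLT hc0] with x hx
  exact (hlt x hx).le

theorem IsShot.exists_first_critical_of_zero (h : IsShot lam ε α R S) (hlam : lambda0 < lam)
    (hε : 0 < ε) (h1 : -√lam ≤ α) (h2 : α < lowerBranch lam 0) {z : ℝ}
    (hz : z ∈ Icc 0 (Real.pi / 2)) (hRz : R z = 0) :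
    ∃ c ∈ Ioo 0 z, (∀ x ∈ Ioo 0 c, S x < 0) ∧ S c = 0 := by
  have hpos : 0 < lam := lambda0_pos.trans hlam
  have hα : α < 0 := h2.trans ((lowerBranch_lt_turningPoint hlam 0).trans (turningPoint_neg hpos))
  have hz0 : 0 < z := by
    refine lt_of_le_of_ne hz.1 fun h0 => ?_
    rw [← h0, h.R_zero] at hRz
    linarith
  obtain ⟨ξ, hξ, hξ'⟩ := exists_hasDerivAt_eq_slope R S hz0 h.continuous_R.continuousOn
    (fun x hx => h.hasDerivAt_R x ⟨hx.1.le, hx.2.le.trans hz.2⟩)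
  have hSξ : 0 < S ξ := by
    rw [hξ', hRz, h.R_zero]
    exact div_pos (by linarith) (by linarith)
  obtain ⟨c, hc, hc1, hc2⟩ := h.exists_first_critical hlam hε h1 h2 hξ.1 hSξ.le
  exact ⟨c, ⟨hc.1, hc.2.trans_lt hξ.2⟩, hc1, hc2⟩

theorem IsTrapped.R_neg_of_le (ht : IsTrapped lam ε e R S σ) (h : IsShot lam ε α R S)
    (hα : α < 0) {r : ℝ} (hr : r ∈ Icc 0 σ) : R r < 0 := by
  have := h.antitoneOn le_rfl ht.lt.le (fun x hx => (ht.S_neg x hx).le)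
    ⟨le_rfl, ht.pos.le⟩ hr hr.1
  rw [h.R_zero] at this
  linarith

/-- The zeros of a trapped shot are uniformly separated. -/
theorem IsTrapped.zeros_separated (ht : IsTrapped lam ε e R S σ) (h : IsShot lam ε α R S)
    (hlam : 0 < lam) (hε : 0 < ε) (he : e ≤ lam ^ 2 / 32) {x y : ℝ} (hx : σ ≤ x) (hxy : x < y)
    (hy : y ≤ Real.pi / 2) (hRx : R x = 0) (hRy : R y = 0) :
    x + lam * ε / (4 * (√lam * lam + 1)) ≤ y := by
  have hσ := ht.pos
  -- The speed, at least λ/(4ε) at the zero, must vanish at a Rolle point ξ < y under an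
  -- acceleration of at most (√λ λ + 1)/ε².
  obtain ⟨ξ, hξ, hξ'⟩ := exists_hasDerivAt_eq_slope R S hxy h.continuous_R.continuousOn
    (fun r hr => h.hasDerivAt_R r ⟨by linarith [hr.1], by linarith [hr.2]⟩)
  rw [hRx, hRy, sub_zero, zero_div] at hξ'
  have h1 := ht.le_abs_S_of_abs_R_le hlam hε he (r := x) ⟨hx, hxy.le.trans hy⟩
    (by rw [hRx]; linarith)
  have h2 := (convex_Icc x ξ).norm_image_sub_le_of_norm_hasDerivWithin_le (f := S)
    (fun r _ => (h.hasDerivAt_S r).hasDerivWithinAt)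
    (fun r _ => abs_clamped_acceleration_le hlam.le _ _) ⟨le_rfl, hξ.1.le⟩ ⟨hξ.1.le, le_rfl⟩
  rw [hξ', zero_sub, norm_neg, Real.norm_eq_abs, Real.norm_eq_abs,
    abs_of_pos (sub_pos.2 hξ.1)] at h2
  have h3 := h1.trans h2
  have h4 : lam * ε / (4 * (√lam * lam + 1)) ≤ ξ - x := by
    rw [div_mul_eq_mul_div, div_le_div_iff₀ (by positivity) (by positivity)] at h3
    rw [div_le_iff₀ (by positivity)]
    have : ε * (lam * ε) ≤ ε * ((ξ - x) * (4 * (√lam * lam + 1))) := by linarith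
    exact le_of_mul_le_mul_left this hε
  linarith [hξ.2]

end Shot

/-! ### Selecting a shot by minimising the starting height -/

section Family

variable {lam ε : ℝ} {R S : ℝ → ℝ → ℝ}

/-- There is a shot whose first critical point is a prescribed time `T`, such that the shots from
below it are decreasing up to `T`. -/
theorem exists_shot_first_critical_eq (hlam : lambda0 < lam) (hε : 0 < ε)
    (hshot : ∀ α, IsShot lam ε α (R α) (S α)) (hR : Continuous fun p : ℝ × ℝ => R p.1 p.2)
    (hS : Continuous fun p : ℝ × ℝ => S p.1 p.2) {T : ℝ} (hT0 : 0 < T) (hT : T < Real.pi / 2) :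
    ∃ α₁ ∈ Ico (-√lam) (lowerBranch lam 0), S α₁ T = 0 ∧
      ∀ α ∈ Icc (-√lam) α₁, ∀ r ∈ Ioo 0 T, S α r < 0 := by
  have hpos : 0 < lam := lambda0_pos.trans hlam
  set b := lowerBranch lam 0 with hb
  have hbk : -√lam < b := neg_sqrt_lt_lowerBranch hlam (by simp)
  have hLc := continuous_lowerBranch hlam
  have hbt := lowerBranch_lt_turningPoint hlam 0
  -- Every shot has S = 0 at r = 0; the condition L ≤ R removes these trivial points for α < L(0)
  -- and keeps the set closed.
  set K : Set (ℝ × ℝ) := (Icc (-√lam) b ×ˢ Icc 0 T) ∩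
    {p | 0 ≤ S p.1 p.2 ∧ lowerBranch lam p.2 ≤ R p.1 p.2} with hK
  have hKc : IsCompact K := (isCompact_Icc.prod isCompact_Icc).inter_right
    ((isClosed_le continuous_const hS).inter (isClosed_le (hLc.comp continuous_snd) hR))
  have hKne : K.Nonempty := ⟨(b, 0), ⟨⟨hbk.le, le_rfl⟩, ⟨le_rfl, hT0.le⟩⟩, by
    change 0 ≤ S b 0 ∧ lowerBranch lam 0 ≤ R b 0
    rw [(hshot b).S_zero, (hshot b).R_zero]
    exact ⟨le_rfl, le_rfl⟩⟩
  obtain ⟨⟨α₁, r₁⟩, hmem, hmin⟩ := hKc.exists_isMinOn hKne continuous_fst.continuousOn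
  obtain ⟨⟨hα₁, hr₁⟩, hS₁, hR₁⟩ := hmem
  simp only at hα₁ hr₁ hS₁ hR₁
  have hdec : ∀ α, -√lam ≤ α → α < b → α < α₁ → ∀ r ∈ Ioc 0 T, S α r < 0 := by
    intro α h1 h2 h3 r hr
    by_contra! hc
    obtain ⟨c, hc0, hc1, hc2⟩ := (hshot α).exists_first_critical hlam hε h1 h2 hr.1 hc
    have hcT : c ≤ T := hc0.2.trans hr.2
    have := (hshot α).lowerBranch_lt_of_first_critical hlam hε h2.le hc0.1 (hcT.trans_lt hT) hc1 hc2
    have hin : (α, c) ∈ K := ⟨⟨⟨h1, h2.le⟩, ⟨hc0.1.le, hcT⟩⟩, hc2.ge, this.2.2.le⟩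
    have : α₁ ≤ α := hmin hin
    linarith
  have hr₁pos : α₁ < b → 0 < r₁ := by
    intro hlt
    refine lt_of_le_of_ne hr₁.1 fun h0 => ?_
    rw [← h0, (hshot α₁).R_zero, ← hb] at hR₁
    linarith
  -- A first critical value lies strictly above −√λ and at most at α₁.
  have hk₁ : -√lam < α₁ := by
    refine lt_of_le_of_ne hα₁.1 fun h0 => ?_
    have hlt : α₁ < b := by rw [← h0]; exact hbk
    obtain ⟨c, hc0, hc1, hc2⟩ :=
      (hshot α₁).exists_first_critical hlam hε hα₁.1 hlt (hr₁pos hlt) hS₁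
    have := (hshot α₁).lowerBranch_lt_of_first_critical hlam hε hlt.le hc0.1
      ((hc0.2.trans hr₁.2).trans_lt hT) hc1 hc2
    linarith
  have hlim : ∀ r ∈ Ioc 0 T, S α₁ r ≤ 0 := by
    intro r hr
    have hc : Continuous fun α => S α r := hS.comp (by fun_prop : Continuous fun α : ℝ => (α, r))
    refine le_of_tendsto (hc.continuousWithinAt (s := Iio α₁) (x := α₁)).tendsto ?_
    filter_upwards [Ioo_mem_nhdsLT hk₁] with α hα
    exact (hdec α hα.1.le (hα.2.trans_le hα₁.2) hα.2 r hr).le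
  have hb₁ : α₁ < b := by
    refine lt_of_le_of_ne hα₁.2 fun heq => ?_
    rw [heq] at hlim
    obtain ⟨r, hr, hr'⟩ := IsShot.exists_S_pos_of_start_on_branch hlam hε (hshot b) hT0
    linarith [hlim r ⟨hr.1, hr.2.le⟩]
  obtain ⟨c, hc0, hc1, hc2⟩ :=
    (hshot α₁).exists_first_critical hlam hε hα₁.1 hb₁ (hr₁pos hb₁) hS₁
  have hcT : c ≤ T := hc0.2.trans hr₁.2
  -- If c < T, positive acceleration at c makes S positive just afterwards, whereas S ≤ 0 on (0, T]
  -- as a limit of the shots from below α₁.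
  have hceq : c = T := by
    refine le_antisymm hcT ?_
    by_contra! hlt
    obtain ⟨b1, b2, b3⟩ := (hshot α₁).lowerBranch_lt_of_first_critical hlam hε hb₁.le hc0.1
      (hcT.trans_lt hT) hc1 hc2
    have h0 := turningPoint_neg hpos
    have hacc : 0 < (cubic lam (clamp (√lam) (R α₁ c)) - Real.cos c) / ε ^ 2 := by
      rw [clamp_of_abs_le (abs_le.2 ⟨b1.le, by linarith [Real.sqrt_nonneg lam]⟩)]
      have := (lowerBranch_lt_iff hlam (r := c) (v := R α₁ c) (by linarith)).1 b3
      exact div_pos (by linarith) (by positivity)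
    obtain ⟨y, hy1, hy2⟩ := ((eventually_gt_of_hasDerivAt_pos ((hshot α₁).hasDerivAt_S c) hacc).and
      (Ioo_mem_nhdsGT hlt)).exists
    rw [hc2] at hy1
    linarith [hlim y ⟨hc0.1.trans hy2.1, hy2.2.le⟩]
  subst hceq
  refine ⟨α₁, ⟨hα₁.1, hb₁⟩, hc2, fun α hα r hr => ?_⟩
  rcases lt_or_eq_of_le hα.2 with h | h
  · exact hdec α hα.1 (h.trans hb₁) h r ⟨hr.1, hr.2.le⟩
  · rw [h]; exact hc1 r hr

/-- The smallness conditions on `δ` and `ε` for solutions with `n` zeros. -/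
structure IsSmall (lam : ℝ) (n : ℕ) (δ ε : ℝ) : Prop where
  ε_pos : 0 < ε
  δ_pos : 0 < δ
  δ_le : δ ≤ Real.pi / 4
  energy : energyDefect lam δ ≤ lam ^ 2 / 32
  tail : 16 * √lam * ε ^ 2 < δ ^ 3
  speed : 16 * √lam * ε ≤ lam * (δ / n)
  drift : 20000 * lam * ε < (δ / n) ^ 2
  hump : 256 * √lam * ε ^ 2 < (δ / n) ^ 3

/-- For small `ε` some shot has exactly `N + 1` zeros in `[0, π/2]`, the last one at `π/2`. -/
theorem exists_shot_with_zeros (hlam : lambda0 < lam)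
    (hshot : ∀ α, IsShot lam ε α (R α) (S α)) (hR : Continuous fun p : ℝ × ℝ => R p.1 p.2)
    (hS : Continuous fun p : ℝ × ℝ => S p.1 p.2) {N : ℕ} {δ : ℝ} (hsm : IsSmall lam (N + 1) δ ε) :
    ∃ α ∈ Ico (-√lam) (lowerBranch lam 0), ∃ σ, Real.pi / 2 - δ ≤ σ ∧
      IsTrapped lam ε (energyDefect lam δ) (R α) (S α) σ ∧
      ∃ z : Fin (N + 1) → ℝ, StrictMono z ∧ (∀ i, z i ∈ Icc 0 (Real.pi / 2)) ∧
        z (Fin.last N) = Real.pi / 2 ∧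
        ∀ x ∈ Icc 0 (Real.pi / 2), R α x = 0 ↔ ∃ i, z i = x := by
  have hpos : 0 < lam := lambda0_pos.trans hlam
  have hε := hsm.ε_pos
  have hδ := hsm.δ_pos
  have hδ' := hsm.δ_le
  have hpi := Real.pi_pos
  obtain ⟨α₁, hα₁, hST, hdec⟩ := exists_shot_first_critical_eq hlam hε hshot hR hS
    (T := Real.pi / 2 - δ) (by linarith) (by linarith)
  have htr : ∀ α ∈ Icc (-√lam) α₁, ∀ x ∈ Icc 0 (Real.pi / 2), R α x = 0 → ∃ σ,
      Real.pi / 2 - δ ≤ σ ∧ σ < x ∧ IsTrapped lam ε (energyDefect lam δ) (R α) (S α) σ := by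
    intro α hα x hx hRx
    have hαb := hα.2.trans_lt hα₁.2
    obtain ⟨c, hc, hc1, hc2⟩ :=
      (hshot α).exists_first_critical_of_zero hlam hε hα.1 hαb hx hRx
    have hcT : Real.pi / 2 - δ ≤ c := by
      by_contra! h
      linarith [hdec α hα c ⟨hc.1, h⟩]
    exact ⟨c, hcT, hc.2, (hshot α).isTrapped hlam hε hαb.le hδ hδ' hsm.tail hcT
      (hc.2.trans_le hx.2) hc1 hc2⟩
  have hneg : ∀ α ∈ Icc (-√lam) α₁, α < 0 := fun α hα =>
    (hα.2.trans_lt hα₁.2).trans ((lowerBranch_lt_turningPoint hlam 0).trans (turningPoint_neg hpos))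
  set d : ℝ := lam * ε / (4 * (√lam * lam + 1)) with hd
  have hdpos : 0 < d := by positivity
  have hsep : ∀ α ∈ Icc (-√lam) α₁, ∀ x ∈ Icc 0 (Real.pi / 2), ∀ y ∈ Icc 0 (Real.pi / 2),
      x < y → R α x = 0 → R α y = 0 → x + d ≤ y := by
    intro α hα x hx y hy hxy hRx hRy
    obtain ⟨σ, -, hσx, ht⟩ := htr α hα x hx hRx
    exact ht.zeros_separated (hshot α) hpos hε hsm.energy hσx.le hxy hy.2 hRx hRy
  -- The uniform gap `d` replaces the strict order of the zeros by a closed condition, so that a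
  -- minimal α is attained with zeros still distinct.
  set K : Set (ℝ × (Fin (N + 1) → ℝ)) :=
    (Icc (-√lam) α₁ ×ˢ Set.pi univ fun _ => Icc 0 (Real.pi / 2)) ∩
    {p | (∀ i, R p.1 (p.2 i) = 0) ∧ ∀ i j, i < j → p.2 i + d ≤ p.2 j} with hK
  have hKc : IsCompact K := by
    refine (isCompact_Icc.prod (isCompact_univ_pi fun _ => isCompact_Icc)).inter_right ?_
    have h1 : IsClosed (⋂ i, {p : ℝ × (Fin (N + 1) → ℝ) | R p.1 (p.2 i) = 0}) :=
      isClosed_iInter fun i => isClosed_eq (hR.comp (by fun_prop :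
        Continuous fun p : ℝ × (Fin (N + 1) → ℝ) => (p.1, p.2 i))) continuous_const
    have h2 : IsClosed (⋂ i, ⋂ j, ⋂ (_ : i < j),
        {p : ℝ × (Fin (N + 1) → ℝ) | p.2 i + d ≤ p.2 j}) :=
      isClosed_iInter fun i => isClosed_iInter fun j => isClosed_iInter fun _ =>
        isClosed_le (by fun_prop) (by fun_prop)
    convert h1.inter h2 using 1
    ext p
    simp
  -- The shot with first critical point π/2 − δ has a zero in each of N + 1 consecutive windows of
  -- length δ/(N + 1).
  have hKne : K.Nonempty := by
    have hn : (0 : ℝ) < ((N + 1 : ℕ) : ℝ) := by positivity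
    set l : ℝ := δ / ((N + 1 : ℕ) : ℝ) with hl
    have hl0 : 0 < l := by positivity
    have hnl : ((N + 1 : ℕ) : ℝ) * l = δ := by rw [hl]; field_simp
    have hα₁m : α₁ ∈ Icc (-√lam) α₁ := ⟨hα₁.1, le_rfl⟩
    have ht := (hshot α₁).isTrapped hlam hε hα₁.2.le hδ hδ' hsm.tail le_rfl
      (by linarith) (hdec α₁ hα₁m) hST
    have hwin : ∀ i : Fin (N + 1), Real.pi / 2 - δ + i * l + l ≤ Real.pi / 2 := by
      intro i
      have h1 : ((i : ℕ) : ℝ) + 1 ≤ ((N + 1 : ℕ) : ℝ) := by exact_mod_cast i.2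
      nlinarith
    have hex : ∀ i : Fin (N + 1), ∃ x ∈ Ioo (Real.pi / 2 - δ + i * l) (Real.pi / 2 - δ + i * l + l),
        R α₁ x = 0 := fun i =>
      ht.exists_zero (hshot α₁) hlam hε hsm.energy (by linarith) hl0
        (by have : 0 ≤ ((i : ℕ) : ℝ) * l := by positivity
            linarith) (hwin i) hsm.speed hsm.drift hsm.hump
    choose z hz hz0 using hex
    have hzm : ∀ i, z i ∈ Icc 0 (Real.pi / 2) := fun i => by
      have : 0 ≤ ((i : ℕ) : ℝ) * l := by positivity
      exact ⟨by linarith [(hz i).1], (hz i).2.le.trans (hwin i)⟩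
    refine ⟨(α₁, z), ⟨hα₁m, fun i _ => hzm i⟩, hz0, fun i j hij => ?_⟩
    refine hsep α₁ hα₁m _ (hzm i) _ (hzm j) ?_ (hz0 i) (hz0 j)
    have h1 : ((i : ℕ) : ℝ) + 1 ≤ ((j : ℕ) : ℝ) := by exact_mod_cast hij
    nlinarith [(hz i).2, (hz j).1]
  obtain ⟨⟨α, z⟩, hmem, hmin⟩ := hKc.exists_isMinOn hKne continuous_fst.continuousOn
  obtain ⟨⟨hα, hzm⟩, hz0, hzs⟩ := hmem
  simp only at hα hzm hz0 hzs
  replace hzm : ∀ i, z i ∈ Icc 0 (Real.pi / 2) := fun i => hzm i trivial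
  have hzmono : StrictMono z := fun i j hij => by linarith [hzs i j hij]
  obtain ⟨σ, hσT, hσz, ht⟩ := htr α hα (z 0) (hzm 0) (hz0 0)
  have hzero_gt : ∀ x ∈ Icc 0 (Real.pi / 2), R α x = 0 → σ < x := by
    intro x hx hRx
    by_contra! hc
    linarith [ht.R_neg_of_le (hshot α) (hneg α hα) ⟨hx.1, hc⟩]
  have hkα : -√lam < α := by
    have := (hshot α).lowerBranch_lt_of_first_critical hlam hε (hα.2.trans hα₁.2.le) ht.pos ht.lt
      ht.S_neg ht.S_eq
    linarith
  -- Simple zeros strictly before π/2 would survive for slightly smaller α, against minimality.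
  have hno : ∀ y : Fin (N + 1) → ℝ, StrictMono y → (∀ i, y i ∈ Ico 0 (Real.pi / 2)) →
      (∀ i, R α (y i) = 0) → False := by
    intro y hy hym hy0
    have hyσ : ∀ i, σ < y i := fun i => hzero_gt _ ⟨(hym i).1, (hym i).2.le⟩ (hy0 i)
    have hev := eventually_exists_zeros hR (a := 0) (b := Real.pi / 2) hy
      (fun i => ⟨ht.pos.trans (hyσ i), (hym i).2⟩) hy0
      (fun i => (hshot α).hasDerivAt_R _ ⟨(hym i).1, (hym i).2.le⟩)
      (fun i => ht.S_ne_zero hpos hε hsm.energy ⟨(hyσ i).le, (hym i).2.le⟩ (hy0 i))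
    obtain ⟨β, ⟨y', hy', hy'm⟩, hβ⟩ :=
      ((hev.filter_mono nhdsWithin_le_nhds).and (Ioo_mem_nhdsLT hkα)).exists
    have hβm : β ∈ Icc (-√lam) α₁ := ⟨hβ.1.le, hβ.2.le.trans hα.2⟩
    have hin : (β, y') ∈ K := ⟨⟨hβm, fun i _ => Ioo_subset_Icc_self (hy'm i).1⟩,
      fun i => (hy'm i).2, fun i j hij => hsep β hβm _ (Ioo_subset_Icc_self (hy'm i).1) _
        (Ioo_subset_Icc_self (hy'm j).1) (hy' hij) (hy'm i).2 (hy'm j).2⟩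
    have : α ≤ β := hmin hin
    linarith [hβ.2]
  have hlast : z (Fin.last N) = Real.pi / 2 := by
    refine le_antisymm (hzm _).2 ?_
    by_contra! hc
    exact hno z hzmono (fun i => ⟨(hzm i).1, (hzmono.monotone (Fin.le_last i)).trans_lt hc⟩) hz0
  refine ⟨α, ⟨hα.1, hα.2.trans_lt hα₁.2⟩, σ, hσT, ht, z, hzmono, hzm, hlast, fun x hx => ⟨fun hRx => ?_, ?_⟩⟩
  · by_contra! hne
    -- An extra zero together with all the z i except the last one would give N + 1 zeros before
    -- π/2.
    set Z : Finset ℝ := insert x (Finset.univ.image (z ∘ Fin.castSucc)) with hZ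
    have hZc : Z.card = N + 1 := by
      rw [hZ, Finset.card_insert_of_notMem (by simpa using fun i : Fin N => hne i.castSucc),
        Finset.card_image_of_injective _ (hzmono.injective.comp (Fin.castSucc_injective N))]
      simp
    have hZm : ∀ y ∈ Z, y ∈ Ico 0 (Real.pi / 2) ∧ R α y = 0 := by
      intro y hy
      simp only [hZ, Finset.mem_insert, Finset.mem_image, Finset.mem_univ, true_and, Function.comp_apply] at hy
      rcases hy with rfl | ⟨i, rfl⟩
      · exact ⟨⟨hx.1, lt_of_le_of_ne hx.2 fun h => hne (Fin.last N) (by rw [hlast, h])⟩, hRx⟩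
      · exact ⟨⟨(hzm _).1, by rw [← hlast]; exact hzmono (Fin.castSucc_lt_last i)⟩, hz0 _⟩
    exact hno (Z.orderEmbOfFin hZc) (Z.orderEmbOfFin hZc).strictMono
      (fun i => (hZm _ (Z.orderEmbOfFin_mem hZc i)).1)
      (fun i => (hZm _ (Z.orderEmbOfFin_mem hZc i)).2)
  · rintro ⟨i, rfl⟩
    exact hz0 i

end Family

/-! ### Alternation and uniqueness of critical points between zeros -/

/-- Just after a zero g is positive, so the next zero is reached from above, with slope at most 0.
-/
theorem eq_of_zeros_of_deriv_pos {g g' : ℝ → ℝ} (hg : ∀ r, HasDerivAt g (g' r) r) {x y : ℝ}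
    (hxy : x < y) (hx : g x = 0) (hy : g y = 0) (hpos : ∀ r ∈ Icc x y, g r = 0 → 0 < g' r) :
    False := by
  have hc : Continuous g := continuous_iff_continuousAt.2 fun r => (hg r).continuousAt
  obtain ⟨p, hp1, hp2⟩ := ((eventually_gt_of_hasDerivAt_pos (hg x)
    (hpos x ⟨le_rfl, hxy.le⟩ hx)).and (Ioo_mem_nhdsGT hxy)).exists
  rw [hx] at hp1
  obtain ⟨c, hc0, hc1, hc2⟩ : ∃ c ∈ Icc p y, 0 ≤ -g c ∧ ∀ s ∈ Ico p c, -g s < 0 :=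
    exists_first_nonneg hc.neg hp2.2.le (by simp [hy])
  have hpc : p < c := lt_of_le_of_ne hc0.1 fun h => by rw [← h] at hc1; linarith
  have hgc : g c = 0 := by
    refine le_antisymm (by linarith)
      (ge_of_tendsto (hc.continuousWithinAt (s := Iio c) (x := c)).tendsto ?_)
    filter_upwards [Ioo_mem_nhdsLT hpc] with r hr
    linarith [hc2 r ⟨hr.1.le, hr.2⟩]
  obtain ⟨q, hq1, hq2⟩ := ((eventually_lt_of_hasDerivAt_pos (hg c)
    (hpos c ⟨hp2.1.le.trans hc0.1, hc0.2⟩ hgc)).and (Ioo_mem_nhdsLT hpc)).exists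
  rw [hgc] at hq1
  linarith [hc2 q ⟨hq2.1.le, hq2.2⟩]

theorem exists_lt_and_mem_Ico {f : ℕ → ℝ} {r : ℝ} (h0 : f 0 ≤ r) {n : ℕ} (hn : r < f n) :
    ∃ i < n, f i ≤ r ∧ r < f (i + 1) := by
  induction n with
  | zero => linarith
  | succ n ih =>
    rcases le_or_gt (f n) r with h | h
    · exact ⟨n, n.lt_succ_self, h, hn⟩
    · obtain ⟨i, hi, h1⟩ := ih h
      exact ⟨i, hi.trans n.lt_succ_self, h1⟩

section Shot

variable {lam ε α e σ : ℝ} {R S : ℝ → ℝ}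

/-- The signs of a trapped shot between its consecutive zeros `f 1 < f 2 < ⋯`. -/
theorem IsTrapped.sign_between_zeros (ht : IsTrapped lam ε e R S σ) (h : IsShot lam ε α R S)
    (hlam : 0 < lam) (hε : 0 < ε) (he : e ≤ lam ^ 2 / 32) {N : ℕ} {f : ℕ → ℝ} (hf0 : f 0 = σ)
    (hf : ∀ i ≤ N, f i < f (i + 1)) (hfm : ∀ i ≤ N, f (i + 1) ∈ Icc σ (Real.pi / 2))
    (hzero : ∀ i ≤ N, R (f (i + 1)) = 0)
    (hne : ∀ i ≤ N, ∀ x ∈ Ioo (f i) (f (i + 1)), R x ≠ 0) (i : ℕ) (hi : i ≤ N) :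
    ∀ x ∈ Ioo (f i) (f (i + 1)), 0 < (-1 : ℝ) ^ (i + 1) * R x := by
  have hcont : ∀ n : ℕ, Continuous fun x => (-1 : ℝ) ^ n * R x := fun n =>
    continuous_const.mul h.continuous_R
  have hpow : ∀ n : ℕ, (-1 : ℝ) ^ n ≠ 0 := fun n => pow_ne_zero _ (by norm_num)
  induction i with
  | zero =>
    have hne0 : ∀ x ∈ Ico (f 0) (f 1), (-1 : ℝ) ^ (0 + 1) * R x ≠ 0 := by
      intro x hx
      refine mul_ne_zero (hpow _) ?_
      rcases eq_or_lt_of_le hx.1 with h1 | h1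
      · rw [← h1, hf0]; exact ht.R_neg.ne
      · exact hne 0 hi x ⟨h1, hx.2⟩
    intro x hx
    refine pos_of_no_zero isPreconnected_Ico (hcont _).continuousOn hne0
      (x₀ := f 0) ⟨le_rfl, hf 0 hi⟩ ?_ x ⟨hx.1.le, hx.2⟩
    rw [hf0, zero_add, pow_one]
    linarith [ht.R_neg]
  | succ i ih =>
    have hi' : i ≤ N := by omega
    have hprev := ih hi'
    have hm := hfm i hi'
    have hd : HasDerivAt R (S (f (i + 1))) (f (i + 1)) :=
      h.hasDerivAt_R _ ⟨ht.pos.le.trans hm.1, hm.2⟩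
    have hS : (-1 : ℝ) ^ (i + 1) * S (f (i + 1)) ≠ 0 :=
      mul_ne_zero (hpow _) (ht.S_ne_zero hlam hε he hm (hzero i hi'))
    have hS' : (-1 : ℝ) ^ (i + 1) * S (f (i + 1)) < 0 := by
      refine lt_of_le_of_ne ?_ hS
      by_contra! hc
      obtain ⟨y, hy1, hy2⟩ := ((eventually_lt_of_hasDerivAt_pos (hd.const_mul _) hc).and
        (Ioo_mem_nhdsLT (hf i hi'))).exists
      simp only [hzero i hi', mul_zero] at hy1
      linarith [hprev y hy2]
    obtain ⟨y, hy1, hy2⟩ := ((eventually_gt_of_hasDerivAt_pos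
      (hd.const_mul ((-1 : ℝ) ^ (i + 1 + 1))) (by rw [pow_succ]; linarith)).and
      (Ioo_mem_nhdsGT (hf (i + 1) hi))).exists
    simp only [hzero i hi', mul_zero] at hy1
    exact pos_of_no_zero isPreconnected_Ioo (hcont _).continuousOn
      (fun x hx => mul_ne_zero (hpow _) (hne (i + 1) hi x hx)) hy2 hy1

/-- The critical points of a trapped shot with `N + 1` zeros, the last one at `π/2`. -/
theorem IsTrapped.exists_critical_points (ht : IsTrapped lam ε e R S σ) (h : IsShot lam ε α R S)
    (hlam : lambda0 < lam) (hε : 0 < ε) (he : e ≤ lam ^ 2 / 32) (h1 : -√lam ≤ α)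
    (h2 : α < lowerBranch lam 0) {N : ℕ} {z : Fin (N + 1) → ℝ} (hz : StrictMono z)
    (hzm : ∀ i, z i ∈ Icc 0 (Real.pi / 2)) (hlast : z (Fin.last N) = Real.pi / 2)
    (hzero : ∀ x ∈ Icc 0 (Real.pi / 2), R x = 0 ↔ ∃ i, z i = x) :
    ∃ c : ℕ → ℝ, c 0 = 0 ∧ c 1 = σ ∧ (∀ k ≤ N, c k < c (k + 1)) ∧
      (∀ k ≤ N, c (k + 1) ∈ Ico σ (Real.pi / 2)) ∧ (∀ k ≤ N + 1, S (c k) = 0) ∧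
      (∀ r ∈ Icc 0 (Real.pi / 2), S r = 0 → ∃ k ≤ N + 1, c k = r) ∧
      (∀ k ≤ N, 0 < (-1 : ℝ) ^ (k + 1) * R (c (k + 1))) ∧
      (∀ k ≤ N + 1, 0 < (-1 : ℝ) ^ (k + 1) *
        ((cubic lam (clamp (√lam) (R (c k))) - Real.cos (c k)) / ε ^ 2)) := by
  have hpos : 0 < lam := lambda0_pos.trans hlam
  have hα : α < 0 := h2.trans ((lowerBranch_lt_turningPoint hlam 0).trans (turningPoint_neg hpos))
  set acc : ℝ → ℝ := fun r => (cubic lam (clamp (√lam) (R r)) - Real.cos r) / ε ^ 2 with hacc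
  -- σ is placed in front of the zeros so that all intervals are treated alike; the value 0 past the
  -- last index is never used.
  obtain ⟨f, hf0, hfs⟩ : ∃ f : ℕ → ℝ, f 0 = σ ∧ ∀ i (hi : i < N + 1), f (i + 1) = z ⟨i, hi⟩ := by
    refine ⟨fun n => match n with
      | 0 => σ
      | i + 1 => if hi : i < N + 1 then z ⟨i, hi⟩ else 0, rfl, fun i hi => ?_⟩
    simp [hi]
  have hRlast : R (Real.pi / 2) = 0 :=
    (hzero _ ⟨by positivity, le_rfl⟩).2 ⟨_, hlast⟩
  have hz0 : σ < z 0 := by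
    by_contra! hc
    exact (ht.R_neg_of_le h hα ⟨(hzm 0).1, hc⟩).ne ((hzero _ (hzm 0)).2 ⟨0, rfl⟩)
  have hzσ : ∀ i, σ < z i := fun i => hz0.trans_le (hz.monotone (Fin.zero_le i))
  have hRz : ∀ i, R (z i) = 0 := fun i =>
    (hzero _ (hzm i)).2 ⟨i, rfl⟩
  have hf : ∀ i ≤ N, f i < f (i + 1) := by
    intro i hi
    rw [hfs i (by omega)]
    cases i with
    | zero => rw [hf0]; exact hz0
    | succ j => rw [hfs j (by omega)]; exact hz (by simp)
  have hfm : ∀ i ≤ N, f (i + 1) ∈ Icc σ (Real.pi / 2) := fun i hi => by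
    rw [hfs i (by omega)]; exact ⟨(hzσ _).le, (hzm _).2⟩
  have hfz : ∀ i ≤ N, R (f (i + 1)) = 0 := fun i hi => by
    rw [hfs i (by omega)]; exact hRz _
  have hfσ : ∀ i ≤ N, σ ≤ f i := by
    intro i hi
    cases i with
    | zero => exact hf0.ge
    | succ j => exact (hfm j (by omega)).1
  have hflast : f (N + 1) = Real.pi / 2 := by
    rw [hfs N (by omega)]; exact hlast
  have hne : ∀ i ≤ N, ∀ x ∈ Ioo (f i) (f (i + 1)), R x ≠ 0 := by
    intro i hi x hx hRx
    have hσx : σ < x := (hfσ i hi).trans_lt hx.1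
    obtain ⟨j, hj⟩ := (hzero x ⟨ht.pos.le.trans hσx.le, hx.2.le.trans (hfm i hi).2⟩).1 hRx
    rw [← hj, hfs i (by omega)] at hx
    have hji : j < ⟨i, by omega⟩ := hz.lt_iff_lt.1 hx.2
    have hji' : (j : ℕ) < i := hji
    cases i with
    | zero => omega
    | succ i =>
      rw [hfs i (by omega)] at hx
      have h3 : (⟨i, by omega⟩ : Fin (N + 1)) < j := hz.lt_iff_lt.1 hx.1
      have h4 : i < (j : ℕ) := h3
      omega
  have hsign := ht.sign_between_zeros h hpos hε he hf0 hf hfm hfz hne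
  have hIn : ∀ i ≤ N, ∀ r, f i ≤ r → r < f (i + 1) → r ∈ Icc σ (Real.pi / 2) := fun i hi r h3 h4 =>
    ⟨(hfσ i hi).trans h3, h4.le.trans (hfm i hi).2⟩
  have hcs : ∀ i ≤ N, ∀ r, f i ≤ r → r < f (i + 1) → S r = 0 →
      0 < (-1 : ℝ) ^ (i + 1) * R r := by
    intro i hi r h3 h4 hS
    rcases eq_or_lt_of_le h3 with h5 | h5
    · cases i with
      | zero => rw [← h5, hf0, zero_add, pow_one]; linarith [ht.R_neg]
      | succ i =>
        rw [← h5] at hS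
        exact absurd hS (ht.S_ne_zero hpos hε he (hfm i (by omega)) (hfz i (by omega)))
    · exact hsign i hi r ⟨h5, h4⟩
  -- At a critical point the acceleration has the sign opposite to R, and R alternates from interval
  -- to interval.
  have hca : ∀ i ≤ N, ∀ r, f i ≤ r → r < f (i + 1) → S r = 0 →
      0 < (-1 : ℝ) ^ i * acc r := by
    intro i hi r h3 h4 hS
    have h5 := hcs i hi r h3 h4 hS
    rcases Nat.even_or_odd i with hp | hp
    · rw [pow_succ, hp.neg_one_pow] at h5
      rw [hp.neg_one_pow, one_mul]
      exact ht.accel_pos hlam hε he (hIn i hi r h3 h4) hS (by linarith)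
    · rw [pow_succ, hp.neg_one_pow] at h5
      rw [hp.neg_one_pow, neg_one_mul, neg_pos]
      exact ht.accel_neg hlam hε (hIn i hi r h3 h4) (by linarith)
  -- The critical point is σ itself for i = 0, which is why f i ≤ x is not strict, and a Rolle point
  -- otherwise.
  have hex : ∀ i, ∃ x, i ≤ N → f i ≤ x ∧ x < f (i + 1) ∧ S x = 0 ∧ (i = 0 → x = σ) := by
    intro i
    cases i with
    | zero => exact ⟨σ, fun hi => ⟨hf0.le, by rw [← hf0]; exact hf 0 hi, ht.S_eq, fun _ => rfl⟩⟩
    | succ i =>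
      by_cases hi : i + 1 ≤ N
      · obtain ⟨x, hx, hx'⟩ := exists_hasDerivAt_eq_slope R S (hf (i + 1) hi)
          h.continuous_R.continuousOn (fun r hr => h.hasDerivAt_R r
            ⟨ht.pos.le.trans ((hfm i (by omega)).1.trans hr.1.le),
              hr.2.le.trans (hfm (i + 1) hi).2⟩)
        rw [hfz (i + 1) hi, hfz i (by omega), sub_zero, zero_div] at hx'
        exact ⟨x, fun _ => ⟨hx.1.le, hx.2, hx', by omega⟩⟩
      · exact ⟨0, fun h => absurd h hi⟩
  choose cc hcc using hex
  have huniq : ∀ i ≤ N, ∀ r, f i ≤ r → r < f (i + 1) → S r = 0 → cc i = r := by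
    intro i hi r h3 h4 hS
    obtain ⟨c1, c2, c3, -⟩ := hcc i hi
    have key : ∀ x y, f i ≤ x → y < f (i + 1) → S x = 0 → S y = 0 → x < y → False := by
      intro x y hx hy hSx hSy hxy
      refine eq_of_zeros_of_deriv_pos (g := fun r => (-1 : ℝ) ^ i * S r)
        (fun r => (h.hasDerivAt_S r).const_mul _) hxy (by simp [hSx]) (by simp [hSy]) ?_
      intro q hq hq0
      refine hca i hi q (hx.trans hq.1) (hq.2.trans_lt hy) ?_
      exact (mul_eq_zero.1 hq0).resolve_left (pow_ne_zero _ (by norm_num))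
    rcases lt_trichotomy (cc i) r with h5 | h5 | h5
    · exact (key _ _ c1 h4 c3 hS h5).elim
    · exact h5
    · exact (key _ _ h3 c2 hS c3 h5).elim
  refine ⟨fun k => match k with
    | 0 => 0
    | k + 1 => cc k, rfl, (hcc 0 (Nat.zero_le _)).2.2.2 rfl, ?_, ?_, ?_, ?_, ?_, ?_⟩
  · intro k hk
    cases k with
    | zero =>
      change 0 < cc 0
      rw [(hcc 0 (Nat.zero_le _)).2.2.2 rfl]
      exact ht.pos
    | succ k => exact (hcc k (by omega)).2.1.trans_le (hcc (k + 1) hk).1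
  · intro k hk
    exact ⟨(hfσ k hk).trans (hcc k hk).1, (hcc k hk).2.1.trans_le (hfm k hk).2⟩
  · intro k hk
    cases k with
    | zero => exact h.S_zero
    | succ k => exact (hcc k (by omega)).2.2.1
  · intro r hr hS
    rcases eq_or_lt_of_le hr.1 with h3 | h3
    · exact ⟨0, Nat.zero_le _, h3⟩
    have hσr : σ ≤ r := by
      by_contra! hc
      exact absurd hS (ht.S_neg r ⟨h3, hc⟩).ne
    have hr2 : r < f (N + 1) := by
      rw [hflast]
      refine lt_of_le_of_ne hr.2 fun h4 => ?_
      rw [h4] at hS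
      exact ht.S_ne_zero hpos hε he ⟨ht.lt.le, le_rfl⟩ hRlast hS
    obtain ⟨i, hi, h4, h5⟩ := exists_lt_and_mem_Ico (by rwa [hf0]) hr2
    exact ⟨i + 1, by omega, huniq i (by omega) r h4 h5 hS⟩
  · intro k hk
    exact hcs k hk _ (hcc k hk).1 (hcc k hk).2.1 (hcc k hk).2.2.1
  · intro k hk
    cases k with
    | zero =>
      change 0 < (-1 : ℝ) ^ (0 + 1) * acc 0
      have h3 : acc 0 < 0 := by
        simp only [hacc]
        rw [cubic_clamp_start hlam h h1 h2.le]
        have := (lt_lowerBranch_iff hlam (r := 0)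
          (h2.trans (lowerBranch_lt_turningPoint hlam 0)).le).1 h2
        exact div_neg_of_neg_of_pos (by linarith) (by positivity)
      rw [zero_add, pow_one]; linarith
    | succ k =>
      have := hca k (by omega) _ (hcc k (by omega)).1 (hcc k (by omega)).2.1 (hcc k (by omega)).2.2.1
      change 0 < (-1 : ℝ) ^ (k + 1 + 1) * acc (cc k)
      rw [pow_succ, pow_succ]
      linarith

end Shot

/-! ### Return to the original time -/

theorem not_isLocalMin_of_deriv_deriv_neg {f : ℝ → ℝ} {x : ℝ} (h : deriv (deriv f) x < 0)
    (hd : deriv f x = 0) (hc : ContinuousAt f x) : ¬ IsLocalMin f x := by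
  intro hmin
  have hmax := isLocalMax_of_deriv_deriv_neg h hd hc
  have heq : f =ᶠ[𝓝 x] fun _ => f x := by
    filter_upwards [hmin, hmax] with y h1 h2
    exact le_antisymm h2 h1
  have h2 := heq.deriv.deriv_eq
  simp at h2
  linarith

theorem not_isLocalMax_of_deriv_deriv_pos {f : ℝ → ℝ} {x : ℝ} (h : 0 < deriv (deriv f) x)
    (hd : deriv f x = 0) (hc : ContinuousAt f x) : ¬ IsLocalMax f x := by
  intro hmax
  have hmin := isLocalMin_of_deriv_deriv_pos h hd hc
  have heq : f =ᶠ[𝓝 x] fun _ => f x := by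
    filter_upwards [hmin, hmax] with y h1 h2
    exact le_antisymm h2 h1
  have h2 := heq.deriv.deriv_eq
  simp at h2
  linarith

/-- An up-wind solution with `m` minima and `m` maxima, whose inner layers are within `η` of their
limits. -/
structure IsUpwind (lam : ℝ) (m : ℕ) (ε η : ℝ) (u : ℝ → ℝ) (s t : ℕ → ℝ) : Prop where
  isSolution : IsSolution lam ε u
  deriv_zero : deriv u 0 = 0
  deriv_pi : deriv u Real.pi = 0
  mid : u (Real.pi / 2) = 0
  deriv_mid : deriv u (Real.pi / 2) < 0
  minima : {x ∈ Icc (Real.pi / 2) Real.pi | IsLocalMin u x} = s '' Icc 1 m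
  maxima : {x ∈ Icc (Real.pi / 2) Real.pi | IsLocalMax u x} = t '' Icc 1 m
  lt_s : Real.pi / 2 < s 1
  s_lt_t : ∀ j ∈ Icc 1 m, s j < t j
  t_lt_s : ∀ j ∈ Ico 1 m, t j < s (j + 1)
  t_last : t m = Real.pi
  tail : ∀ x ∈ Ioo (s m) Real.pi,
    0 < deriv u x ∧ Ulow lam (Real.pi / 2) < u x ∧ u x < Ulow lam Real.pi
  s_near : ∀ j ∈ Icc 1 m, |s j - Real.pi / 2| ≤ η ∧ |u (s j) - Ulow lam (Real.pi / 2)| ≤ η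
  t_near : ∀ j ∈ Ico 1 m, |t j - Real.pi / 2| ≤ η ∧ |u (t j) - Ubar lam (Real.pi / 2)| ≤ η

theorem IsUpwind.mono {lam ε η η' : ℝ} {m : ℕ} {u : ℝ → ℝ} {s t : ℕ → ℝ} (hη : η ≤ η')
    (h : IsUpwind lam m ε η u s t) : IsUpwind lam m ε η' u s t :=
  { h with
    s_near := fun j hj => ⟨(h.s_near j hj).1.trans hη, (h.s_near j hj).2.trans hη⟩
    t_near := fun j hj => ⟨(h.t_near j hj).1.trans hη, (h.t_near j hj).2.trans hη⟩ }

theorem isSolution_of_reversed {lam ε : ℝ} (hε : 0 < ε) {R S : ℝ → ℝ}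
    (hR : ∀ r, HasDerivAt R (S r) r)
    (hS : ∀ r, HasDerivAt S ((cubic lam (R r) - Real.cos r) / ε ^ 2) r) :
    IsSolution lam ε (fun t => R (Real.pi - t)) ∧
      (∀ t, deriv (fun t => R (Real.pi - t)) t = -S (Real.pi - t)) ∧
      ∀ t, deriv (deriv fun t => R (Real.pi - t)) t =
        (cubic lam (R (Real.pi - t)) - Real.cos (Real.pi - t)) / ε ^ 2 := by
  have e0 : ∀ t, HasDerivAt (fun t => Real.pi - t) (-1) t := fun t => by
    simpa using (hasDerivAt_id t).const_sub Real.pi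
  have e1 : ∀ t, HasDerivAt (fun t => R (Real.pi - t)) (-S (Real.pi - t)) t := fun t => by
    simpa [Function.comp_def] using (hR (Real.pi - t)).scomp t (e0 t)
  have e2 : ∀ t, HasDerivAt (fun t => -S (Real.pi - t))
      ((cubic lam (R (Real.pi - t)) - Real.cos (Real.pi - t)) / ε ^ 2) t := fun t => by
    have : HasDerivAt (fun t => S (Real.pi - t))
        (-((cubic lam (R (Real.pi - t)) - Real.cos (Real.pi - t)) / ε ^ 2)) t := by
      simpa only [Function.comp_def, smul_eq_mul, neg_one_mul] using
        (hS (Real.pi - t)).scomp t (e0 t)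
    simpa only [neg_neg] using this.fun_neg
  have d1 : deriv (fun t => R (Real.pi - t)) = fun t => -S (Real.pi - t) :=
    funext fun t => (e1 t).deriv
  have d2 : deriv (deriv fun t => R (Real.pi - t)) =
      fun t => (cubic lam (R (Real.pi - t)) - Real.cos (Real.pi - t)) / ε ^ 2 := by
    rw [d1]; exact funext fun t => (e2 t).deriv
  refine ⟨⟨?_, fun t => ?_⟩, fun t => congrFun d1 t, fun t => congrFun d2 t⟩
  · rw [show (2 : WithTop ℕ∞) = 1 + 1 by norm_num, contDiff_succ_iff_deriv]
    refine ⟨fun t => (e1 t).differentiableAt, by simp, ?_⟩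
    rw [contDiff_one_iff_deriv, d2, d1]
    refine ⟨fun t => (e2 t).differentiableAt, ?_⟩
    have hRc : Continuous R := continuous_iff_continuousAt.2 fun r => (hR r).continuousAt
    unfold cubic
    fun_prop
  · rw [d2]
    simp only [Real.cos_pi_sub, cubic]
    field_simp
    ring

theorem abs_sub_sqrt_le {lam η v : ℝ} (hlam : 0 < lam) (hη : 0 ≤ η) (hv : 0 ≤ v) (hv' : v ≤ √lam)
    (h : (v ^ 2 - lam) ^ 2 ≤ lam * η ^ 2) : √lam - v ≤ η := by
  have hk := Real.sqrt_pos.2 hlam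
  have hk2 := Real.sq_sqrt hlam.le
  have h1 : lam - v ^ 2 ≤ √lam * η := by
    apply le_of_sq_le_sq _ (by positivity)
    rw [mul_pow, hk2]
    linarith [show (lam - v ^ 2) ^ 2 = (v ^ 2 - lam) ^ 2 by ring]
  have h2 : √lam * (√lam - v) ≤ √lam * η := by nlinarith [mul_nonneg hv (sub_nonneg.2 hv')]
  exact le_of_mul_le_mul_left h2 hk

/-- With m = p + 1, the 2p + 1 zeros yield 2p + 2 critical points c 0 = 0, c 1 = σ, …, alternately
maxima (even index) and minima (odd index). -/
theorem exists_isUpwind {lam : ℝ} (hlam : lambda0 < lam) (p : ℕ) {δ ε η : ℝ}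
    (hsm : IsSmall lam (2 * p + 1) δ ε) (hδη : δ ≤ η) (heη : energyDefect lam δ ≤ lam * η ^ 2 / 4) :
    ∃ u s t, IsUpwind lam (p + 1) ε η u s t := by
  have hpos : 0 < lam := lambda0_pos.trans hlam
  have hε := hsm.ε_pos
  have hpi := Real.pi_pos
  have hη : 0 < η := hsm.δ_pos.trans_le hδη
  obtain ⟨R', S', hshot', hR', hS', hext'⟩ := exists_shots hpos hε
  obtain ⟨α, hα, σ, hσ, ht, z, hz, hzm, hlast, hzero⟩ :=
    exists_shot_with_zeros hlam hshot' hR' hS' (N := 2 * p) hsm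
  obtain ⟨c, c0, c1, cmono, cmem, cS, call, cR, cacc⟩ := ht.exists_critical_points (hshot' α) hlam
    hε hsm.energy hα.1 hα.2 hz hzm hlast hzero
  have h := hshot' α
  have hext := hext' α
  set R := R' α with hRdef
  set S := S' α with hSdef
  have hmidR : R (Real.pi / 2) = 0 := (hzero _ ⟨by positivity, le_rfl⟩).2 ⟨_, hlast⟩
  have hα0 : α < 0 :=
    hα.2.trans ((lowerBranch_lt_turningPoint hlam 0).trans (turningPoint_neg hpos))
  have hanti := h.strictAntiOn le_rfl ht.lt.le ht.S_neg
  have habs : ∀ r ∈ Icc 0 (Real.pi / 2), |R r| ≤ √lam := by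
    intro r hr
    rcases le_total r σ with h1 | h1
    · have h2 := hanti.antitoneOn ⟨hr.1, h1⟩ ⟨ht.pos.le, le_rfl⟩ h1
      have h3 := ht.R_neg_of_le h hα0 ⟨hr.1, h1⟩
      exact abs_le.2 ⟨by linarith [ht.R_lower], by linarith [Real.sqrt_nonneg lam]⟩
    · exact ht.abs_le hlam ⟨h1, hr.2⟩
  obtain ⟨hdR, hdS, hSpi⟩ := hext habs hmidR
  obtain ⟨hsol, hd1, hd2⟩ := isSolution_of_reversed hε hdR hdS
  set u : ℝ → ℝ := fun t => R (Real.pi - t) with hu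
  have huc : ∀ x, ContinuousAt u x := fun x => hsol.1.continuous.continuousAt
  have cmem' : ∀ k ≤ 2 * p + 1, c k ∈ Icc 0 (Real.pi / 2) := by
    intro k hk
    cases k with
    | zero => rw [c0]; exact ⟨le_rfl, by positivity⟩
    | succ k =>
      have := cmem k (by omega)
      exact ⟨ht.pos.le.trans this.1, this.2.le⟩
  have hcrit : ∀ k ≤ 2 * p + 1, deriv u (Real.pi - c k) = 0 := by
    intro k hk
    rw [hd1, sub_sub_cancel, cS k hk, neg_zero]
  have hacc : ∀ k ≤ 2 * p + 1, 0 < (-1 : ℝ) ^ (k + 1) * deriv (deriv u) (Real.pi - c k) := by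
    intro k hk
    have := cacc k hk
    rwa [clamp_of_abs_le (habs _ (cmem' k hk)), ← sub_sub_cancel Real.pi (c k), ← hd2] at this
  have hodd : ∀ i ≤ p, 0 < deriv (deriv u) (Real.pi - c (2 * i + 1)) := by
    intro i hi
    have := hacc (2 * i + 1) (by omega)
    rwa [show 2 * i + 1 + 1 = 2 * (i + 1) by ring, (even_two_mul (i + 1)).neg_one_pow, one_mul] at this
  have heven : ∀ i ≤ p, deriv (deriv u) (Real.pi - c (2 * i)) < 0 := by
    intro i hi
    have := hacc (2 * i) (by omega)
    rw [pow_succ, (even_two_mul i).neg_one_pow] at this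
    linarith
  have hform : ∀ x ∈ Icc (Real.pi / 2) Real.pi, deriv u x = 0 →
      ∃ i ≤ p, x = Real.pi - c (2 * i) ∨ x = Real.pi - c (2 * i + 1) := by
    intro x hx hdx
    rw [hd1, neg_eq_zero] at hdx
    obtain ⟨k, hk, hck⟩ := call (Real.pi - x) ⟨by linarith [hx.2], by linarith [hx.1]⟩ hdx
    refine ⟨k / 2, by omega, ?_⟩
    rcases Nat.even_or_odd' k with ⟨i, rfl | rfl⟩
    · left
      rw [show 2 * (2 * i / 2) = 2 * i by omega, hck]; ring
    · right
      rw [show 2 * ((2 * i + 1) / 2) + 1 = 2 * i + 1 by omega, hck]; ring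
  have hmemI : ∀ k ≤ 2 * p + 1, Real.pi - c k ∈ Icc (Real.pi / 2) Real.pi := fun k hk =>
    ⟨by linarith [(cmem' k hk).2], by linarith [(cmem' k hk).1]⟩
  have hlow : Ulow lam (Real.pi / 2) = -√lam := Ulow_pi_div_two hlam
  have hval : ∀ k ≤ 2 * p, (R (c (k + 1)) ^ 2 - lam) ^ 2 ≤ lam * η ^ 2 := by
    intro k hk
    have := ht.sq_le_of_S_eq_zero ⟨(cmem k hk).1, (cmem k hk).2.le⟩ (cS (k + 1) (by omega))
    linarith
  have hnear : ∀ k ≤ 2 * p, |Real.pi - c (k + 1) - Real.pi / 2| ≤ η := by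
    intro k hk
    have := cmem k hk
    exact abs_le.2 ⟨by linarith [this.2], by linarith [this.1]⟩
  -- Time reversal turns the order around: j = p + 1 corresponds to c 1 = σ and c 0 = 0, the latter
  -- giving t_m = π.
  refine ⟨u, fun j => Real.pi - c (2 * (p + 1 - j) + 1), fun j => Real.pi - c (2 * (p + 1 - j)),
    ?_⟩
  refine ⟨hsol, ?_, ?_, ?_, ?_, ?_, ?_, ?_, ?_, ?_, ?_, ?_, ?_, ?_⟩
  · rw [hd1, sub_zero, hSpi, neg_zero]
  · rw [hd1, sub_self, h.S_zero, neg_zero]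
  · simp only [hu]
    rw [show Real.pi - Real.pi / 2 = Real.pi / 2 by ring, hmidR]
  · rw [hd1, show Real.pi - Real.pi / 2 = Real.pi / 2 by ring, neg_lt_zero]
    -- Otherwise R would rise from a negative value at the last critical point c (2p + 1) to 0 at
    -- π/2 and arrive there with S ≤ 0, which forces a later critical point.
    by_contra! hneg
    have hcl := cmem (2 * p) le_rfl
    have hRc := cR (2 * p) le_rfl
    rw [pow_succ, (even_two_mul p).neg_one_pow] at hRc
    obtain ⟨ξ, hξ, hξ'⟩ := exists_hasDerivAt_eq_slope R S hcl.2 h.continuous_R.continuousOn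
      (fun r _ => hdR r)
    have hSξ : 0 < S ξ := by
      rw [hξ', hmidR]
      exact div_pos (by linarith) (by linarith [hcl.2])
    obtain ⟨y, hy, hSy⟩ := intermediate_value_Icc' hξ.2.le h.continuous_S.continuousOn
      ⟨hneg, hSξ.le⟩
    obtain ⟨k, hk, hck⟩ := call y
      ⟨(ht.pos.le.trans hcl.1).trans (hξ.1.le.trans hy.1), hy.2⟩ hSy
    have hle : ∀ d k, k + d = 2 * p + 1 → c k ≤ c (2 * p + 1) := by
      intro d
      induction d with
      | zero => intro k hk; rw [← hk, add_zero]
      | succ d ih => intro k hk; exact (cmono k (by omega)).le.trans (ih (k + 1) (by omega))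
    have := hle (2 * p + 1 - k) k (by omega)
    linarith [hξ.1, hy.1]
  · ext x
    constructor
    · rintro ⟨hx, hmin⟩
      have hdx := hmin.deriv_eq_zero
      obtain ⟨i, hi, hxi | hxi⟩ := hform x hx hdx
      · exact absurd hmin (not_isLocalMin_of_deriv_deriv_neg (by rw [hxi]; exact heven i hi) hdx
          (huc x))
      · refine ⟨p + 1 - i, ⟨by omega, by omega⟩, ?_⟩
        simp only
        rw [hxi, show p + 1 - (p + 1 - i) = i by omega]
    · rintro ⟨j, hj, rfl⟩
      have hj2 : p + 1 - j ≤ p := by have := hj.1; omega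
      exact ⟨hmemI _ (by omega), isLocalMin_of_deriv_deriv_pos (hodd _ hj2) (hcrit _ (by omega))
        (huc _)⟩
  · ext x
    constructor
    · rintro ⟨hx, hmax⟩
      have hdx := hmax.deriv_eq_zero
      obtain ⟨i, hi, hxi | hxi⟩ := hform x hx hdx
      · refine ⟨p + 1 - i, ⟨by omega, by omega⟩, ?_⟩
        simp only
        rw [hxi, show p + 1 - (p + 1 - i) = i by omega]
      · exact absurd hmax (not_isLocalMax_of_deriv_deriv_pos (by rw [hxi]; exact hodd i hi) hdx
          (huc x))
    · rintro ⟨j, hj, rfl⟩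
      have hj2 : p + 1 - j ≤ p := by have := hj.1; omega
      exact ⟨hmemI _ (by omega), isLocalMax_of_deriv_deriv_neg (heven _ hj2) (hcrit _ (by omega))
        (huc _)⟩
  · simp only [Nat.add_sub_cancel]
    linarith [(cmem (2 * p) le_rfl).2]
  · intro j hj
    have := cmono (2 * (p + 1 - j)) (by have := hj.1; omega)
    linarith
  · intro j hj
    have h1 := cmono (2 * (p + 1 - (j + 1)) + 1) (by have := hj.1; have := hj.2; omega)
    have h2 : 2 * (p + 1 - (j + 1)) + 1 + 1 = 2 * (p + 1 - j) := by have := hj.2; omega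
    rw [h2] at h1
    linarith
  · simp [c0]
  · intro x hx
    simp only [Nat.sub_self, mul_zero, zero_add, c1] at hx
    have hr : Real.pi - x ∈ Ioo 0 σ := ⟨by linarith [hx.2], by linarith [hx.1]⟩
    refine ⟨?_, ?_, ?_⟩
    · rw [hd1]; linarith [ht.S_neg _ hr]
    · rw [hlow]
      exact ht.R_lower.trans (hanti ⟨hr.1.le, hr.2.le⟩ ⟨ht.pos.le, le_rfl⟩ hr.2)
    · have h1 := hanti ⟨le_rfl, ht.pos.le⟩ ⟨hr.1.le, hr.2.le⟩ hr.1
      rw [h.R_zero] at h1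
      have h2 : lowerBranch lam 0 = Ulow lam Real.pi := by unfold lowerBranch; rw [sub_zero]
      rw [← h2]
      exact h1.trans hα.2
  · intro j hj
    have hk : 2 * (p + 1 - j) ≤ 2 * p := by have := hj.1; omega
    refine ⟨hnear _ hk, ?_⟩
    have h1 := cR _ hk
    rw [pow_succ, (even_two_mul _).neg_one_pow] at h1
    have h2 := habs _ (cmem' (2 * (p + 1 - j) + 1) (by omega))
    rw [abs_le] at h2
    have h3 := abs_sub_sqrt_le hpos hη.le (v := -R (c (2 * (p + 1 - j) + 1))) (by linarith)
      (by linarith) (by rw [neg_sq]; exact hval _ hk)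
    rw [hlow]
    simp only [hu, sub_sub_cancel]
    exact abs_le.2 ⟨by linarith, by linarith⟩
  · intro j hj
    obtain ⟨q, hq⟩ : ∃ q, p + 1 - j = q + 1 := ⟨p - j, by have := hj.2; omega⟩
    have hk : 2 * q + 1 ≤ 2 * p := by have := hj.1; omega
    simp only [hq, show 2 * (q + 1) = 2 * q + 1 + 1 by ring]
    refine ⟨hnear _ hk, ?_⟩
    have h1 := cR _ hk
    rw [show 2 * q + 1 + 1 = 2 * (q + 1) by ring, (even_two_mul _).neg_one_pow, one_mul,
      show 2 * (q + 1) = 2 * q + 1 + 1 by ring] at h1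
    have h2 := habs _ (cmem' (2 * q + 1 + 1) (by omega))
    rw [abs_le] at h2
    have h3 := abs_sub_sqrt_le hpos hη.le h1.le h2.2 (hval _ hk)
    rw [Ubar_pi_div_two hlam]
    simp only [hu, sub_sub_cancel]
    exact abs_le.2 ⟨by linarith, by linarith⟩

/-! ### One family for all tolerances -/

/-- A diagonal choice: for each ε take a witness for the finest tolerance 1/(n + 1) attainable with
n ≤ ⌈1/ε⌉. The cap makes the greatest index exist and does not obstruct any fixed tolerance as ε →
0. -/
theorem exists_uniform_choice {X : Type*} {P : ℝ → ℝ → X → Prop}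
    (mono : ∀ ε η η' x, η ≤ η' → P ε η x → P ε η' x)
    (h : ∀ η > 0, ∃ ε₀ > 0, ∀ ε ∈ Ioo 0 ε₀, ∃ x, P ε η x) :
    ∃ ε₀ > 0, ∃ f : ℝ → X, (∀ ε ∈ Ioo 0 ε₀, P ε 1 (f ε)) ∧
      ∀ η > 0, ∃ ε₁ > 0, ∀ ε ∈ Ioo 0 ε₁, P ε η (f ε) := by
  classical
  obtain ⟨ε₀, hε₀, h0⟩ := h 1 one_pos
  obtain ⟨x₀, -⟩ := h0 (ε₀ / 2) ⟨by linarith, by linarith⟩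
  let Q : ℝ → ℕ → Prop := fun ε n => ∃ x, P ε (1 / ((n : ℝ) + 1)) x
  let idx : ℝ → ℕ := fun ε => Nat.findGreatest (Q ε) ⌈1 / ε⌉₊
  let f : ℝ → X := fun ε => if hx : Q ε (idx ε) then hx.choose else x₀
  have hf : ∀ ε n, n ≤ ⌈1 / ε⌉₊ → Q ε n → P ε (1 / ((n : ℝ) + 1)) (f ε) := by
    intro ε n hn hQ
    have hle : n ≤ idx ε := Nat.le_findGreatest hn hQ
    have hspec : Q ε (idx ε) := Nat.findGreatest_spec (P := Q ε) hn hQ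
    have : P ε (1 / ((idx ε : ℝ) + 1)) (f ε) := by
      simp only [f, dif_pos hspec]
      exact hspec.choose_spec
    refine mono _ _ _ _ ?_ this
    have hle' : (n : ℝ) ≤ idx ε := by exact_mod_cast hle
    exact one_div_le_one_div_of_le (by positivity) (by linarith)
  refine ⟨ε₀, hε₀, f, fun ε hε => ?_, fun η hη => ?_⟩
  · have := hf ε 0 (Nat.zero_le _) (by simpa [Q] using h0 ε hε)
    simpa using this
  · obtain ⟨n, hn⟩ := exists_nat_one_div_lt hη
    have hn0 : (0 : ℝ) < (n : ℝ) + 1 := by positivity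
    obtain ⟨ε₁, hε₁, h1⟩ := h (1 / ((n : ℝ) + 1)) (by positivity)
    refine ⟨min ε₁ (1 / ((n : ℝ) + 1)), by positivity, fun ε hε => ?_⟩
    refine mono _ _ _ _ hn.le (hf ε n ?_ (h1 ε ⟨hε.1, hε.2.trans_le (min_le_left _ _)⟩))
    have h2 : ε < 1 / ((n : ℝ) + 1) := hε.2.trans_le (min_le_right _ _)
    have h3 : (n : ℝ) + 1 < 1 / ε := by
      rw [lt_div_iff₀ hn0] at h2
      rw [lt_div_iff₀ hε.1]
      linarith
    have h4 : (n : ℝ) ≤ ⌈1 / ε⌉₊ := by linarith [Nat.le_ceil (1 / ε)]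
    exact_mod_cast h4

/-- δ is fixed first, to make the energy defect small; ε is then taken small in terms of δ and n. -/
theorem exists_isSmall {lam : ℝ} (hlam : 0 < lam) (n : ℕ) (hn : 0 < n) {η : ℝ} (hη : 0 < η) :
    ∃ δ ≤ η, energyDefect lam δ ≤ lam * η ^ 2 / 4 ∧
      ∃ ε₀ > 0, ∀ ε ∈ Ioo 0 ε₀, IsSmall lam n δ ε := by
  have lim : ∀ {g : ℝ → ℝ} {a : ℝ}, Continuous g → g 0 < a → ∀ᶠ x in 𝓝[>] (0 : ℝ), g x < a :=
    fun hg h0 => ((hg.tendsto 0).mono_left nhdsWithin_le_nhds).eventually (gt_mem_nhds h0)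
  have hec : Continuous (energyDefect lam) := by unfold energyDefect; fun_prop
  have he0 : energyDefect lam 0 = 0 := by simp [energyDefect]
  have hn' : (0 : ℝ) < n := by exact_mod_cast hn
  obtain ⟨δ, ⟨⟨⟨h1, h2⟩, h3⟩, h4⟩, hδ⟩ := ((((lim continuous_id hη).and
    (lim continuous_id (show (0 : ℝ) < Real.pi / 4 by positivity))).and
    (lim hec (show energyDefect lam 0 < lam * η ^ 2 / 4 by rw [he0]; positivity))).and
    (lim hec (show energyDefect lam 0 < lam ^ 2 / 32 by rw [he0]; positivity))).and
    self_mem_nhdsWithin |>.exists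
  have hδ : 0 < δ := hδ
  refine ⟨δ, h1.le, h3.le, ?_⟩
  have hev : ∀ᶠ ε in 𝓝[>] (0 : ℝ), IsSmall lam n δ ε := by
    filter_upwards [self_mem_nhdsWithin,
      lim (g := fun ε => 16 * √lam * ε ^ 2) (a := δ ^ 3) (by fun_prop) (by simp; positivity),
      lim (g := fun ε => 16 * √lam * ε) (a := lam * (δ / n)) (by fun_prop) (by simp; positivity),
      lim (g := fun ε => 20000 * lam * ε) (a := (δ / n) ^ 2) (by fun_prop) (by simp; positivity),
      lim (g := fun ε => 256 * √lam * ε ^ 2) (a := (δ / n) ^ 3) (by fun_prop) (by simp; positivity)]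
      with ε e1 e2 e3 e4 e5
    exact ⟨e1, hδ, h2.le, h4.le, e2, e3.le, e4, e5⟩
  obtain ⟨ε₀, hε₀, hsub⟩ := mem_nhdsGT_iff_exists_Ioo_subset.1 hev
  exact ⟨ε₀, hε₀, fun ε hε => hsub hε⟩

theorem tendsto_of_eventually_abs_sub_le {g : ℝ → ℝ} {a : ℝ}
    (h : ∀ η > 0, ∃ ε₁ > 0, ∀ ε ∈ Ioo 0 ε₁, |g ε - a| ≤ η) : Tendsto g (𝓝[>] 0) (𝓝 a) := by
  rw [Metric.tendsto_nhds]
  intro η hη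
  obtain ⟨ε₁, hε₁, h1⟩ := h (η / 2) (by linarith)
  filter_upwards [Ioo_mem_nhdsGT hε₁] with ε hε
  rw [Real.dist_eq]
  linarith [h1 ε hε]

end ForcedDuffing

theorem mainTheorem8 (lam : ℝ) (hlam : ForcedDuffing.lambda0 < lam) (m : ℕ) (hm : 1 ≤ m) :
    ∃ εm : ℝ, 0 < εm ∧ ∃ (u : ℝ → ℝ → ℝ) (s t : ℝ → ℕ → ℝ),
      (∀ ε ∈ Ioo 0 εm,
        ForcedDuffing.IsSolution lam ε (u ε) ∧
        deriv (u ε) 0 = 0 ∧ deriv (u ε) Real.pi = 0 ∧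
        u ε (Real.pi / 2) = 0 ∧ deriv (u ε) (Real.pi / 2) < 0 ∧
        -- the minima and the maxima in `[π/2, π]` are exactly `s₁, …, s_m` and `t₁, …, t_m`
        {x ∈ Icc (Real.pi / 2) Real.pi | IsLocalMin (u ε) x} = s ε '' Icc 1 m ∧
        {x ∈ Icc (Real.pi / 2) Real.pi | IsLocalMax (u ε) x} = t ε '' Icc 1 m ∧
        -- `π/2 < s₁ < t₁ < s₂ < t₂ < ⋯ < s_m < t_m = π`
        Real.pi / 2 < s ε 1 ∧
        (∀ j ∈ Icc 1 m, s ε j < t ε j) ∧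
        (∀ j ∈ Ico 1 m, t ε j < s ε (j + 1)) ∧
        t ε m = Real.pi ∧
        (∀ x ∈ Ioo (s ε m) Real.pi,
          0 < deriv (u ε) x ∧
          ForcedDuffing.Ulow lam (Real.pi / 2) < u ε x ∧
          u ε x < ForcedDuffing.Ulow lam Real.pi)) ∧
      -- all the minima collapse to `π/2`, with values tending to the lower branch
      (∀ j ∈ Icc 1 m,
        Tendsto (fun ε => s ε j) (𝓝[>] 0) (𝓝 (Real.pi / 2)) ∧
        Tendsto (fun ε => u ε (s ε j)) (𝓝[>] 0) (𝓝 (ForcedDuffing.Ulow lam (Real.pi / 2)))) ∧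
      -- all but the last maximum collapse to `π/2`, with values tending to the upper branch
      (∀ j ∈ Ico 1 m,
        Tendsto (fun ε => t ε j) (𝓝[>] 0) (𝓝 (Real.pi / 2)) ∧
        Tendsto (fun ε => u ε (t ε j)) (𝓝[>] 0) (𝓝 (ForcedDuffing.Ubar lam (Real.pi / 2)))) := by
  obtain ⟨p, rfl⟩ : ∃ p, m = p + 1 := ⟨m - 1, by omega⟩
  have hpos : 0 < lam := ForcedDuffing.lambda0_pos.trans hlam
  obtain ⟨ε₀, hε₀, f, hf, hlim⟩ := ForcedDuffing.exists_uniform_choice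
    (X := (ℝ → ℝ) × (ℕ → ℝ) × (ℕ → ℝ))
    (P := fun ε η x => ForcedDuffing.IsUpwind lam (p + 1) ε η x.1 x.2.1 x.2.2)
    (fun ε η η' x h hx => hx.mono h) (fun η hη => by
      obtain ⟨δ, hδη, he, ε₀, hε₀, hsm⟩ :=
        ForcedDuffing.exists_isSmall hpos (2 * p + 1) (by omega) hη
      refine ⟨ε₀, hε₀, fun ε hε => ?_⟩
      obtain ⟨u, s, t, h⟩ := ForcedDuffing.exists_isUpwind hlam p (hsm ε hε) hδη he
      exact ⟨(u, s, t), h⟩)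
  refine ⟨ε₀, hε₀, fun ε => (f ε).1, fun ε => (f ε).2.1, fun ε => (f ε).2.2, fun ε hε => ?_,
    fun j hj => ⟨?_, ?_⟩, fun j hj => ⟨?_, ?_⟩⟩
  · have h := hf ε hε
    exact ⟨h.isSolution, h.deriv_zero, h.deriv_pi, h.mid, h.deriv_mid, h.minima, h.maxima, h.lt_s,
      h.s_lt_t, h.t_lt_s, h.t_last, h.tail⟩
  all_goals
    refine ForcedDuffing.tendsto_of_eventually_abs_sub_le fun η hη => ?_
    obtain ⟨ε₁, hε₁, h1⟩ := hlim η hη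
    refine ⟨ε₁, hε₁, fun ε hε => ?_⟩
  · exact ((h1 ε hε).s_near j hj).1
  · exact ((h1 ε hε).s_near j hj).2
  · exact ((h1 ε hε).t_near j hj).1
  · exact ((h1 ε hε).t_near j hj).2
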